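/- Fix $\vartheta\in(0,1)$ and $r>0$. For each $p$ let $\Omega=\Omega_{p}$ be a symmetric positive definite $p\times p$ real matrix with $\Omega(i,i)=1$ for all $i$, and suppose that the maximal number $d_p^*=\max_{i}\#\{j:\Omega_p(i,j)\neq 0\}$ of nonzero entries in a row satisfies $d_p^*\,p^{-\delta}\to 0$ as $p\to\infty$ for every fixed $\delta>0$. Consider the model $ARW(\vartheta,r,\Omega)$: one observes $Y=\beta+z\in\mathbb{R}^p$ with $z\sim N(0,\Omega^{-1})$, and tests $$H_0^{(p)}:\ \beta=0\qquad\text{against}\qquad H_1^{(p)}:\ \beta_1,\dots,\beta_p\ \overset{iid}{\sim}\ (1-\epsilon_p)\nu_0+\epsilon_p\nu_{\tau_p},\quad \beta \text{ independent of } z,$$ where $\nu_a$ is the point mass at $a$, $\epsilon_p=p^{-\vartheta}$ and $\tau_p=\sqrt{2r\log p}$. Let $$\rho^*(\vartheta)=\begin{cases}0,&0<\vartheta\le 1/2,\\ \vartheta-1/2,&1/2<\vartheta\le 3/4,\\ (1-\sqrt{1-\vartheta})^2,&3/4<\vartheta<1.\end{cases}$$ (i) If $r<\rho^*(\vartheta)$,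 then for every sequence of (possibly randomized) tests of $H_0^{(p)}$ against $H_1^{(p)}$, the sum of the Type I and Type II errors tends to $1$ as $p\to\infty$. (ii) If $r>\rho^*(\vartheta)$, then there is a sequence of (non-randomized) tests of $H_0^{(p)}$ against $H_1^{(p)}$ for which the sum of the Type I and Type II errors tends to $0$ as $p\to\infty$. In particular the detection boundary $r=\rho^*(\vartheta)$ is the same for all such $\Omega$ as for $\Omega=I_p$. -/

import Mathlib

open MeasureTheory ProbabilityTheory Filter Topology

noncomputable section

namespace ARW

/-- The standard phase function for detection, `ρ*(ϑ)`, for `0 < ϑ < 1`. -/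
def rhoStar (ϑ : ℝ) : ℝ :=
  if ϑ ≤ 1 / 2 then 0
  else if ϑ ≤ 3 / 4 then ϑ - 1 / 2
  else (1 - Real.sqrt (1 - ϑ)) ^ 2

/-- The maximum number of nonzero entries in a row of `Ω`. -/
def maxRowNonzeros {p : ℕ} (Ω : Matrix (Fin p) (Fin p) ℝ) : ℕ :=
  Finset.univ.sup fun i : Fin p => (Finset.univ.filter fun j : Fin p => Ω i j ≠ 0).card

/-- The sequence of precision matrices of the model: each `Ω p` is a genuine precision matrix
(symmetric positive definite) with unit diagonal, and the maximum number of nonzeros per row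
grows more slowly than every positive power of `p`. -/
structure IsSparsePrecision (Ω : ∀ p : ℕ, Matrix (Fin p) (Fin p) ℝ) : Prop where
  posDef : ∀ p, (Ω p).PosDef
  diag : ∀ p i, Ω p i i = 1
  sparse : ∀ δ : ℝ, 0 < δ →
    Tendsto (fun p : ℕ => (maxRowNonzeros (Ω p) : ℝ) * (p : ℝ) ^ (-δ)) atTop (𝓝 0)

/-- The proportion of signals, `ε_p = p ^ (-ϑ)`. -/
def eps (ϑ : ℝ) (p : ℕ) : ℝ := (p : ℝ) ^ (-ϑ)

/-- The signal strength, `τ_p = √(2 r log p)`. -/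
def tau (r : ℝ) (p : ℕ) : ℝ := Real.sqrt (2 * r * Real.log p)

/-- The two-point law `(1 - ε) ν₀ + ε ν_τ` on the line (for `0 ≤ ε ≤ 1`). -/
def twoPoint (ε τ : ℝ) : Measure ℝ :=
  ENNReal.ofReal (1 - ε) • Measure.dirac 0 + ENNReal.ofReal ε • Measure.dirac τ

/-- The law of `β` in the rare and weak model: the coordinates are independent and identically
distributed with law `(1 - ε_p) ν₀ + ε_p ν_{τ_p}`. -/
def signalLaw (ϑ r : ℝ) (p : ℕ) : Measure (EuclideanSpace ℝ (Fin p)) :=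
  (Measure.pi fun _ : Fin p => twoPoint (eps ϑ p) (tau r p)).map (WithLp.toLp 2)

/-- The law of `Y = β + z`, where `β` has law `prior` and `z ∼ N(0, Ω⁻¹)` is independent
of `β`. -/
def obsLaw {p : ℕ} (Ω : Matrix (Fin p) (Fin p) ℝ) (prior : Measure (EuclideanSpace ℝ (Fin p))) :
    Measure (EuclideanSpace ℝ (Fin p)) :=
  (prior.prod (multivariateGaussian 0 Ω⁻¹)).map fun x => x.1 + x.2

/-- The law of `Y` under the null hypothesis `β = 0`. -/
def nullLaw {p : ℕ} (Ω : Matrix (Fin p) (Fin p) ℝ) : Measure (EuclideanSpace ℝ (Fin p)) :=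
  obsLaw Ω (Measure.dirac 0)

/-- The law of `Y` under the alternative hypothesis that `β` follows the rare and weak model. -/
def altLaw (ϑ r : ℝ) {p : ℕ} (Ω : Matrix (Fin p) (Fin p) ℝ) :
    Measure (EuclideanSpace ℝ (Fin p)) :=
  obsLaw Ω (signalLaw ϑ r p)

/-- A (possibly randomized) test: `φ y` is the probability of rejecting the null hypothesis when
`Y = y` is observed. -/
def IsTest {p : ℕ} (φ : EuclideanSpace ℝ (Fin p) → ℝ) : Prop :=
  Measurable φ ∧ ∀ y, 0 ≤ φ y ∧ φ y ≤ 1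

/-- A non-randomized test: it always either rejects (`1`) or accepts (`0`). -/
def IsNonrandomizedTest {p : ℕ} (φ : EuclideanSpace ℝ (Fin p) → ℝ) : Prop :=
  IsTest φ ∧ ∀ y, φ y = 0 ∨ φ y = 1

/-- Type I error: the probability of rejecting under the null hypothesis. -/
def typeI {p : ℕ} (Ω : Matrix (Fin p) (Fin p) ℝ) (φ : EuclideanSpace ℝ (Fin p) → ℝ) : ℝ :=
  ∫ y, φ y ∂(nullLaw Ω)

/-- Type II error: the probability of not rejecting under the alternative hypothesis. -/
def typeII (ϑ r : ℝ) {p : ℕ} (Ω : Matrix (Fin p) (Fin p) ℝ)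
    (φ : EuclideanSpace ℝ (Fin p) → ℝ) : ℝ :=
  ∫ y, (1 - φ y) ∂(altLaw ϑ r Ω)

end ARW

end

/-!
The parameter of the problem enters only through the scores `x = Ω Y`, which have unit variances and
covariance matrix `Ω`. A signal at an index `i` with no other signal nearby shifts the score `x i`
by exactly `τ`, as it would for `Ω = 1`; sparsity of `Ω` makes signals isolated and scores mostly
uncorrelated, so that the calculation for independent coordinates survives up to powers of the
row size `d`, which grows more slowly than every positive power of `p`.

*Impossibility.* Conditionally on the set `S` of signals, the law of `Y` has density `lik Ω (τ 1_S)`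
with respect to the null law (`map_add_noise`). The mixture over `S` is truncated twice: to the sets
`S` that are `Isolated`, meaning that no row of `Ω` has two nonzero entries in `S`, and to the event
that no score in `S` exceeds `√(2 log p)`. The removed mass is at most
`p d² ε² + p ε exp (-(T - τ)² / 2)` (`le_integral_mixLik`). For two isolated sets `S`, `S'`, the
pairs `(i, j) ∈ S × S'` with `Ω i j ≠ 0` form a matching, so the Gaussian integral of the product of
their truncated likelihood ratios is at most `K ^ m`, where `m` is the number of matched elements of
`S'` and `K` bounds the truncated second moment of the likelihood ratio of a single signal
(`integral_truncLik_mul_le`). The truncation is used through the exponential Markov inequality, so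
only the Gaussian moment-generating function is needed. Averaging over independent `S`, `S'` gives
the bound `(1 + ε ((1 + ε K) ^ d - 1)) ^ p` for the second moment (`integral_mixLik_sq_le`). Below
the boundary both the mass and the second moment tend to `1`, so the truncated likelihood ratio
tends to `1` in `L¹` of the null law.

*Possibility.* The test counts the scores that exceed a level `t`. Exceedances at `i` and `j` are
independent as soon as rows `i` and `j` of `Ω` have disjoint supports (`rareLaw_exceed_inter`), so
under both hypotheses the variance of the count is at most `d²` times its mean. The signals raise
the mean by about `p ε P(N(τ, 1) > t)`, and Chebyshev's inequality concludes
(`errors_countTest_le`). The level `t = σ √(2 log p)` with `σ = min (2 √r) 1` works everywhere above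
the boundary (`exists_exponent_of_rhoStar_lt`).
-/

noncomputable section

namespace ARW

open Matrix

/-! ### Gaussian noise with covariance `Ω⁻¹` -/

section Noise

variable {ι : Type*} [Fintype ι]

/-- The linear statistic `aᵀ Ω y` of the observation `y`. -/
def score (Ω : Matrix ι ι ℝ) (a : ι → ℝ) (y : EuclideanSpace ℝ ι) : ℝ :=
  a ⬝ᵥ Ω *ᵥ y.ofLp

/-- The bilinear form `aᵀ Ω b`, which is the covariance of `score Ω a` and `score Ω b` under
`N(0, Ω⁻¹)`. -/
def quad (Ω : Matrix ι ι ℝ) (a b : ι → ℝ) : ℝ := a ⬝ᵥ Ω *ᵥ b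

variable {Ω : Matrix ι ι ℝ}

lemma score_add (a b : ι → ℝ) (y : EuclideanSpace ℝ ι) :
    score Ω (a + b) y = score Ω a y + score Ω b y := add_dotProduct _ _ _

lemma score_smul (c : ℝ) (a : ι → ℝ) (y : EuclideanSpace ℝ ι) :
    score Ω (c • a) y = c * score Ω a y := smul_dotProduct _ _ _

lemma score_toLp (a b : ι → ℝ) : score Ω a (WithLp.toLp 2 b) = quad Ω a b := rfl

lemma score_add_right (a : ι → ℝ) (y z : EuclideanSpace ℝ ι) :
    score Ω a (y + z) = score Ω a y + score Ω a z := by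
  simp [score, mulVec_add, dotProduct_add]

lemma quad_add_left (a b c : ι → ℝ) : quad Ω (a + b) c = quad Ω a c + quad Ω b c :=
  add_dotProduct _ _ _

lemma quad_add_right (a b c : ι → ℝ) : quad Ω a (b + c) = quad Ω a b + quad Ω a c := by
  simp [quad, mulVec_add, dotProduct_add]

lemma quad_smul_left (t : ℝ) (a b : ι → ℝ) : quad Ω (t • a) b = t * quad Ω a b :=
  smul_dotProduct _ _ _

lemma quad_smul_right (t : ℝ) (a b : ι → ℝ) : quad Ω a (t • b) = t * quad Ω a b := by
  simp [quad, mulVec_smul, dotProduct_smul]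

lemma quad_comm (hΩ : Ω.PosDef) (a b : ι → ℝ) : quad Ω a b = quad Ω b a := by
  have h : Ωᵀ = Ω := by simpa using hΩ.isHermitian.eq
  rw [quad, quad, dotProduct_mulVec, dotProduct_comm, ← mulVec_transpose, h]

lemma quad_self_nonneg (hΩ : Ω.PosDef) (a : ι → ℝ) : 0 ≤ quad Ω a a := by
  simpa [quad] using hΩ.posSemidef.dotProduct_mulVec_nonneg a

lemma score_eq_inner (hΩ : Ω.PosDef) (a : ι → ℝ) (y : EuclideanSpace ℝ ι) :
    score Ω a y = inner ℝ (WithLp.toLp 2 (Ω *ᵥ a)) y := by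
  change quad Ω a y.ofLp = _
  rw [quad_comm hΩ, EuclideanSpace.inner_eq_star_dotProduct]
  simp [quad]

@[fun_prop]
lemma continuous_score (a : ι → ℝ) : Continuous (score Ω a) := by
  unfold score
  fun_prop

@[fun_prop]
lemma measurable_score (a : ι → ℝ) : Measurable (score Ω a) := (continuous_score a).measurable

/-- The likelihood ratio of `N(b, Ω⁻¹)` with respect to `N(0, Ω⁻¹)`. -/
def lik (Ω : Matrix ι ι ℝ) (b : ι → ℝ) (y : EuclideanSpace ℝ ι) : ℝ :=
  Real.exp (score Ω b y - quad Ω b b / 2)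

@[fun_prop]
lemma measurable_lik (b : ι → ℝ) : Measurable (lik Ω b) := by
  unfold lik; fun_prop

lemma lik_pos (b : ι → ℝ) (y : EuclideanSpace ℝ ι) : 0 < lik Ω b y := Real.exp_pos _

variable [DecidableEq ι]

/-- The law `N(0, Ω⁻¹)` of the noise, which is also the law of the observation under the null. -/
abbrev noise (Ω : Matrix ι ι ℝ) : Measure (EuclideanSpace ℝ ι) := multivariateGaussian 0 Ω⁻¹

lemma covariance_score (hΩ : Ω.PosDef) (a b : ι → ℝ) :
    cov[score Ω a, score Ω b; noise Ω] = quad Ω a b := by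
  have h (a : ι → ℝ) : score Ω a = fun y => inner ℝ (WithLp.toLp 2 (Ω *ᵥ a)) y :=
    funext (score_eq_inner hΩ a)
  rw [h a, h b, ← covarianceBilin_apply_eq_cov IsGaussian.memLp_two_id,
    covarianceBilin_multivariateGaussian hΩ.inv.posSemidef]
  have hu : IsUnit Ω.det := (Matrix.isUnit_iff_isUnit_det _).1 hΩ.isUnit
  rw [mulVec_mulVec, nonsing_inv_mul _ hu, one_mulVec, dotProduct_comm]
  exact quad_comm hΩ b a

lemma map_score (hΩ : Ω.PosDef) (a : ι → ℝ) :
    (noise Ω).map (score Ω a) = gaussianReal 0 (quad Ω a a).toNNReal := by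
  have h : score Ω a = (innerSL ℝ (WithLp.toLp 2 (Ω *ᵥ a)) : StrongDual ℝ _) := by
    ext y; rw [score_eq_inner hΩ]; rfl
  rw [← covariance_score hΩ, covariance_self (by fun_prop), h, IsGaussian.map_eq_gaussianReal]
  congr 1
  have := (innerSL ℝ (WithLp.toLp 2 (Ω *ᵥ a))).integral_comp_comm
    (IsGaussian.integrable_id (μ := noise Ω))
  simp only [id] at this
  rw [this, integral_id_multivariateGaussian, map_zero]

lemma integrable_exp_score (hΩ : Ω.PosDef) (a : ι → ℝ) (c : ℝ) :
    Integrable (fun y => Real.exp (score Ω a y + c)) (noise Ω) := by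
  have h := integrable_exp_mul_gaussianReal (μ := 0) (v := (quad Ω a a).toNNReal) 1
  rw [← map_score hΩ, integrable_map_measure (by fun_prop) (by fun_prop)] at h
  simp_rw [Real.exp_add]
  exact (h.congr (by simp [Function.comp_def])).mul_const _

lemma integral_exp_score (hΩ : Ω.PosDef) (a : ι → ℝ) (c : ℝ) :
    ∫ y, Real.exp (score Ω a y + c) ∂(noise Ω) = Real.exp (quad Ω a a / 2 + c) := by
  have h := mgf_gaussianReal (map_score hΩ a) 1
  rw [mgf] at h
  simp_rw [Real.exp_add, integral_mul_const]
  simp only [one_mul] at h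
  rw [h]
  simp [Real.coe_toNNReal _ (quad_self_nonneg hΩ a)]

lemma integrable_lik (hΩ : Ω.PosDef) (b : ι → ℝ) : Integrable (lik Ω b) (noise Ω) := by
  refine (integrable_exp_score hΩ b (-(quad Ω b b / 2))).congr (ae_of_all _ fun y => ?_)
  simp only [lik, sub_eq_add_neg]

lemma integral_lik (hΩ : Ω.PosDef) (b : ι → ℝ) : ∫ y, lik Ω b y ∂(noise Ω) = 1 := by
  simp only [lik, sub_eq_add_neg]
  rw [integral_exp_score hΩ b (-(quad Ω b b / 2))]
  simp

lemma exists_score_eq (hΩ : Ω.PosDef) (L : StrongDual ℝ (EuclideanSpace ℝ ι)) :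
    ∃ a, ∀ y, L y = score Ω a y := by
  have hu : IsUnit Ω.det := (Matrix.isUnit_iff_isUnit_det _).1 hΩ.isUnit
  refine ⟨Ω⁻¹ *ᵥ ((InnerProductSpace.toDual ℝ _).symm L).ofLp, fun y => ?_⟩
  rw [score_eq_inner hΩ, mulVec_mulVec, mul_nonsing_inv _ hu, one_mulVec]
  simp

/-- The Cameron–Martin formula: translating the noise by `b` multiplies its law by `lik Ω b`.
Both sides have the same moment-generating function along every linear functional. -/
lemma map_add_noise (hΩ : Ω.PosDef) (b : ι → ℝ) :
    (noise Ω).map (fun z => WithLp.toLp 2 b + z) =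
      (noise Ω).withDensity (fun y => ENNReal.ofReal (lik Ω b y)) := by
  have hprob : IsProbabilityMeasure ((noise Ω).withDensity fun y => ENNReal.ofReal (lik Ω b y)) :=
    ⟨by
      rw [withDensity_apply _ .univ, Measure.restrict_univ, ← ofReal_integral_eq_lintegral_ofReal
        (integrable_lik hΩ b) (ae_of_all _ fun y => (lik_pos b y).le), integral_lik hΩ b]
      simp⟩
  have : IsProbabilityMeasure ((noise Ω).map fun z => WithLp.toLp 2 b + z) :=
    Measure.isProbabilityMeasure_map (by fun_prop)
  apply Measure.ext_of_charFunDual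
  ext L
  rw [charFunDual_eq_charFun_map_one, charFunDual_eq_charFun_map_one]
  congr 1
  obtain ⟨a, ha⟩ := exists_score_eq hΩ L
  have hL : (L : EuclideanSpace ℝ ι → ℝ) = score Ω a := funext ha
  rw [hL]
  have hint (t : ℝ) : Integrable (fun y => Real.exp (t * score Ω a y))
      ((noise Ω).map fun z => WithLp.toLp 2 b + z) := by
    rw [integrable_map_measure (by fun_prop) (by fun_prop)]
    refine (integrable_exp_score hΩ (t • a) (t * quad Ω a b)).congr (ae_of_all _ fun y => ?_)
    simp only [Function.comp, score_add_right, score_smul, score_toLp]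
    congr 1; ring
  have hmgf : mgf (score Ω a) ((noise Ω).map fun z => WithLp.toLp 2 b + z) =
      mgf (score Ω a) ((noise Ω).withDensity fun y => ENNReal.ofReal (lik Ω b y)) := by
    ext t
    rw [mgf, mgf, integral_map (by fun_prop) (by fun_prop),
      integral_withDensity_eq_integral_toReal_smul (by fun_prop) (by simp)]
    have h1 (y : EuclideanSpace ℝ ι) : Real.exp (t * score Ω a (WithLp.toLp 2 b + y)) =
        Real.exp (score Ω (t • a) y + t * quad Ω a b) := by
      simp only [score_add_right, score_smul, score_toLp]
      congr 1; ring
    have h2 (y : EuclideanSpace ℝ ι) :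
        (ENNReal.ofReal (lik Ω b y)).toReal • Real.exp (t * score Ω a y) =
        Real.exp (score Ω (t • a + b) y + -(quad Ω b b / 2)) := by
      rw [ENNReal.toReal_ofReal (lik_pos b y).le, smul_eq_mul, lik, ← Real.exp_add]
      simp only [score_add, score_smul]
      congr 1; ring
    simp_rw [h1, h2]
    rw [integral_exp_score hΩ, integral_exp_score hΩ]
    simp only [quad_add_left, quad_add_right, quad_smul_left, quad_smul_right, quad_comm hΩ b a]
    congr 1; ring
  refine Measure.ext_of_complexMGF_eq (by fun_prop) (by fun_prop) ?_
  ext z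
  refine eqOn_complexMGF_of_mgf hmgf ?_
  have : integrableExpSet (score Ω a) ((noise Ω).map fun z => WithLp.toLp 2 b + z) = Set.univ :=
    Set.eq_univ_of_forall hint
  simp [this]

lemma integral_map_add_noise (hΩ : Ω.PosDef) (b : ι → ℝ) (f : EuclideanSpace ℝ ι → ℝ) :
    ∫ y, f y ∂((noise Ω).map fun z => WithLp.toLp 2 b + z) =
      ∫ y, lik Ω b y * f y ∂(noise Ω) := by
  rw [map_add_noise hΩ, integral_withDensity_eq_integral_toReal_smul (by fun_prop) (by simp)]
  simp [ENNReal.toReal_ofReal (lik_pos b _).le]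

/-- Scores that are uncorrelated are independent. -/
lemma indepFun_score (hΩ : Ω.PosDef) {a b : ι → ℝ} (h : quad Ω a b = 0) :
    IndepFun (score Ω a) (score Ω b) (noise Ω) := by
  refine HasGaussianLaw.indepFun_of_covariance_eq_zero ⟨?_⟩ (by rw [covariance_score hΩ, h])
  let M : EuclideanSpace ℝ ι →L[ℝ] ℝ × ℝ := ContinuousLinearMap.prod
    (innerSL ℝ (WithLp.toLp 2 (Ω *ᵥ a))) (innerSL ℝ (WithLp.toLp 2 (Ω *ᵥ b)))
  have hM : (fun y => (score Ω a y, score Ω b y)) = M := by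
    ext y <;> simp [M, score_eq_inner hΩ]
  rw [hM]
  infer_instance

end Noise

/-! ### The rare signals -/

section Prior

variable {ι : Type*} [Fintype ι] [DecidableEq ι]

/-- The probability that the set of signals is exactly `S`, when each index carries a signal
independently with probability `ε`. -/
def weight (ε : ℝ) (S : Finset ι) : ℝ := ∏ i, if i ∈ S then ε else 1 - ε

/-- The indicator vector of `S`. -/
def ind (S : Finset ι) : ι → ℝ := fun i => if i ∈ S then 1 else 0

lemma weight_nonneg {ε : ℝ} (h0 : 0 ≤ ε) (h1 : ε ≤ 1) (S : Finset ι) : 0 ≤ weight ε S :=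
  Finset.prod_nonneg fun i _ => by split_ifs <;> linarith

lemma prod_add_eq_sum_ite {R : Type*} [CommSemiring R] (f g : ι → R) :
    ∏ i, (f i + g i) = ∑ S : Finset ι, ∏ i, if i ∈ S then f i else g i := by
  rw [Finset.prod_add, Finset.powerset_univ]
  refine Finset.sum_congr rfl fun S _ => ?_
  rw [Finset.prod_ite]
  congr 1 <;> refine Finset.prod_congr ?_ fun _ _ => rfl <;> ext <;> simp

/-- The expectation of a product over the independent indices. -/
lemma sum_weight_mul_prod (ε : ℝ) (u v : ι → ℝ) :
    ∑ S, weight ε S * ∏ i, (if i ∈ S then u i else v i) =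
      ∏ i, (ε * u i + (1 - ε) * v i) := by
  rw [prod_add_eq_sum_ite]
  refine Finset.sum_congr rfl fun S _ => ?_
  rw [weight, ← Finset.prod_mul_distrib]
  refine Finset.prod_congr rfl fun i _ => ?_
  split_ifs <;> rfl

lemma sum_weight (ε : ℝ) : ∑ S : Finset ι, weight ε S = 1 := by
  simpa using sum_weight_mul_prod ε (fun _ : ι => 1) (fun _ => 1)

/-- All the indices in `A` carry a signal with probability `ε ^ #A`. -/
lemma sum_weight_subset (ε : ℝ) (A : Finset ι) :
    ∑ S, weight ε S * (if A ⊆ S then 1 else 0) = ε ^ A.card := by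
  have h := sum_weight_mul_prod ε (fun _ : ι => 1) (fun i => if i ∈ A then 0 else 1)
  have h2 : ∏ i, (ε * 1 + (1 - ε) * (if i ∈ A then 0 else 1)) = ε ^ A.card := by
    rw [← Finset.prod_const, ← Finset.prod_subset (Finset.subset_univ A)]
    · exact Finset.prod_congr rfl fun i hi => by simp [hi]
    · intro i _ hi; simp [hi]
  rw [← h2, ← h]
  refine Finset.sum_congr rfl fun S _ => ?_
  congr 1
  split_ifs with hA
  · refine (Finset.prod_eq_one fun i _ => ?_).symm
    by_cases hi : i ∈ S
    · simp [hi]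
    · have : i ∉ A := fun h => hi (hA h)
      simp [hi, this]
  · obtain ⟨i, hiA, hiS⟩ := Finset.not_subset.1 hA
    exact (Finset.prod_eq_zero (Finset.mem_univ i) (by simp [hiA, hiS])).symm

lemma sum_weight_mul_card (ε : ℝ) :
    ∑ S : Finset ι, weight ε S * (S.card : ℝ) = Fintype.card ι * ε := by
  have h (S : Finset ι) : weight ε S * (S.card : ℝ) =
      ∑ i, weight ε S * (if {i} ⊆ S then 1 else 0) := by
    rw [← Finset.mul_sum]; simp
  simp_rw [h]
  rw [Finset.sum_comm]
  simp_rw [sum_weight_subset]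
  simp

/-- The number of signals in `N` has the binomial generating function. -/
lemma sum_weight_mul_pow (ε K : ℝ) (N : Finset ι) :
    ∑ S, weight ε S * K ^ (S ∩ N).card = (1 + ε * (K - 1)) ^ N.card := by
  have h := sum_weight_mul_prod ε (fun i : ι => if i ∈ N then K else 1) (fun _ => 1)
  have h2 : ∏ i, (ε * (if i ∈ N then K else 1) + (1 - ε) * 1) = (1 + ε * (K - 1)) ^ N.card := by
    rw [← Finset.prod_const, ← Finset.prod_subset (Finset.subset_univ N)]
    · exact Finset.prod_congr rfl fun i hi => by simp [hi]; ring
    · intro i _ hi; simp [hi]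
  rw [← h2, ← h]
  refine Finset.sum_congr rfl fun S _ => ?_
  congr 1
  rw [← Finset.prod_const, ← Finset.prod_subset (Finset.subset_univ (S ∩ N))]
  · exact Finset.prod_congr rfl fun i hi => by simp_all
  · intro i _ hi
    by_cases h : i ∈ S <;> simp_all

instance isProbabilityMeasure_twoPoint (ε τ : ℝ) [h : Fact (ε ∈ Set.Icc (0 : ℝ) 1)] :
    IsProbabilityMeasure (twoPoint ε τ) := ⟨by
  have h1 := h.out.1
  have h2 := h.out.2
  simp [twoPoint, ← ENNReal.ofReal_add (sub_nonneg.2 h2) h1]⟩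

/-- The prior is the mixture, over the possible sets of signals `S`, of the point masses at
`τ 1_S`. -/
lemma pi_twoPoint (ε τ : ℝ) (hε : ε ∈ Set.Icc (0 : ℝ) 1) :
    (Measure.pi fun _ : ι => twoPoint ε τ) =
      ∑ S : Finset ι, ENNReal.ofReal (weight ε S) • Measure.dirac (τ • ind S) := by
  have : Fact (ε ∈ Set.Icc (0 : ℝ) 1) := ⟨hε⟩
  refine Measure.pi_eq fun s hs => ?_
  simp only [twoPoint, Measure.coe_add, Measure.coe_smul, Pi.add_apply, Pi.smul_apply,
    Measure.coe_finsetSum, Finset.sum_apply, smul_eq_mul]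
  rw [Finset.prod_congr rfl fun i _ => add_comm _ _, prod_add_eq_sum_ite]
  refine Finset.sum_congr rfl fun S _ => ?_
  rw [weight, ENNReal.ofReal_prod_of_nonneg
    (fun i _ => by split_ifs <;> linarith [hε.1, hε.2]),
    Measure.dirac_apply' _ (MeasurableSet.univ_pi hs)]
  have h : (Set.univ.pi s).indicator (1 : (ι → ℝ) → ENNReal) (τ • ind S) =
      ∏ i, (s i).indicator (1 : ℝ → ENNReal) (if i ∈ S then τ else 0) := by
    by_cases hS : τ • ind S ∈ Set.univ.pi s
    · rw [Set.indicator_of_mem hS]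
      refine (Finset.prod_eq_one fun i _ => ?_).symm
      have := hS i (Set.mem_univ i)
      rw [Set.indicator_of_mem]
      · rfl
      · simpa [ind] using this
    · rw [Set.indicator_of_notMem hS]
      simp only [Set.mem_univ_pi, not_forall] at hS
      obtain ⟨i, hi⟩ := hS
      refine (Finset.prod_eq_zero (Finset.mem_univ i) (Set.indicator_of_notMem ?_ _)).symm
      have h : (τ • ind S) i = if i ∈ S then τ else 0 := by simp [ind]
      rwa [h] at hi
  rw [h, ← Finset.prod_mul_distrib]
  refine Finset.prod_congr rfl fun i _ => ?_
  split_ifs <;> rw [Measure.dirac_apply' _ (hs i)]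

end Prior

lemma altLaw_eq_sum (ϑ r : ℝ) {p : ℕ} (hε : eps ϑ p ∈ Set.Icc (0 : ℝ) 1)
    (Ω : Matrix (Fin p) (Fin p) ℝ) :
    altLaw ϑ r Ω = ∑ S : Finset (Fin p), ENNReal.ofReal (weight (eps ϑ p) S) •
      (noise Ω).map fun z => WithLp.toLp 2 (tau r p • ind S) + z := by
  rw [altLaw, obsLaw, signalLaw, pi_twoPoint _ _ hε]
  ext s hs
  have hm : Measurable fun x : EuclideanSpace ℝ (Fin p) × EuclideanSpace ℝ (Fin p) =>
    x.1 + x.2 := by fun_prop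
  rw [Measure.map_apply hm hs, Measure.prod_apply (hm hs),
    lintegral_map (measurable_measure_prodMk_left (hm hs)) (by fun_prop),
    lintegral_finsetSum_measure]
  simp only [Measure.coe_finsetSum, Finset.sum_apply, Measure.coe_smul, Pi.smul_apply]
  refine Finset.sum_congr rfl fun S _ => ?_
  rw [lintegral_smul_measure, lintegral_dirac, Measure.map_apply (by fun_prop) hs]
  rfl

lemma nullLaw_eq {p : ℕ} (Ω : Matrix (Fin p) (Fin p) ℝ) : nullLaw Ω = noise Ω := by
  have hm : Measurable fun x : EuclideanSpace ℝ (Fin p) × EuclideanSpace ℝ (Fin p) =>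
    x.1 + x.2 := by fun_prop
  rw [nullLaw, obsLaw, Measure.dirac_prod, Measure.map_map hm (by fun_prop)]
  simp [Function.comp_def]

/-- The expectation of a bounded statistic under the alternative, as a likelihood-weighted
expectation under the null. -/
lemma integral_altLaw (ϑ r : ℝ) {p : ℕ} (hε : eps ϑ p ∈ Set.Icc (0 : ℝ) 1)
    {Ω : Matrix (Fin p) (Fin p) ℝ} (hΩ : Ω.PosDef) {f : EuclideanSpace ℝ (Fin p) → ℝ}
    (hf : Measurable f) (hb : ∀ y, |f y| ≤ 1) :
    ∫ y, f y ∂(altLaw ϑ r Ω) = ∑ S : Finset (Fin p), weight (eps ϑ p) S *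
      ∫ y, lik Ω (tau r p • ind S) y * f y ∂(noise Ω) := by
  rw [altLaw_eq_sum ϑ r hε, integral_finsetSum_measure]
  · refine Finset.sum_congr rfl fun S _ => ?_
    rw [integral_smul_measure, integral_map_add_noise hΩ,
      ENNReal.toReal_ofReal (weight_nonneg hε.1 hε.2 S), smul_eq_mul]
  · intro S _
    have : IsProbabilityMeasure ((noise Ω).map fun z => WithLp.toLp 2 (tau r p • ind S) + z) :=
      Measure.isProbabilityMeasure_map (by fun_prop)
    refine Integrable.smul_measure ?_ (by simp)
    exact Integrable.of_bound hf.aestronglyMeasurable 1 (ae_of_all _ hb)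

/-! ### Sparse precision matrices -/

section Sparse

open Matrix

variable {ι : Type*} {Ω : Matrix ι ι ℝ}

/-- The indices `j` with `Ω i j ≠ 0`. -/
def nbr [Fintype ι] (Ω : Matrix ι ι ℝ) (i : ι) : Finset ι := {j | Ω i j ≠ 0}

@[simp]
lemma mem_nbr [Fintype ι] {i j : ι} : j ∈ nbr Ω i ↔ Ω i j ≠ 0 := by simp [nbr]

lemma entry_comm (hΩ : Ω.PosDef) (i j : ι) : Ω i j = Ω j i := by
  simpa using (hΩ.isHermitian.apply i j).symm

/-- A set of indices is isolated if no row of `Ω` has nonzero entries at two of its elements. -/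
def Isolated (Ω : Matrix ι ι ℝ) (S : Finset ι) : Prop :=
  ∀ k, ∀ i ∈ S, ∀ j ∈ S, Ω k i ≠ 0 → Ω k j ≠ 0 → i = j

instance (S : Finset ι) : Decidable (Isolated Ω S) := Classical.propDecidable _

lemma Isolated.sum_eq_one {S : Finset ι} (hS : Isolated Ω S) (hd : ∀ i, Ω i i = 1) {j : ι}
    (hj : j ∈ S) : ∑ i ∈ S, Ω i j = 1 := by
  rw [Finset.sum_eq_single_of_mem j hj, hd]
  intro i hi hij
  by_contra h
  exact hij (hS i i hi j hj (by simp [hd]) h)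

lemma Isolated.mono {S J : Finset ι} (hS : Isolated Ω S) (hJ : J ⊆ S) : Isolated Ω J :=
  fun k i hi j hj => hS k i (hJ hi) j (hJ hj)

variable [Fintype ι] [DecidableEq ι]

lemma quad_ind (S S' : Finset ι) : quad Ω (ind S) (ind S') = ∑ j ∈ S', ∑ i ∈ S, Ω i j := by
  rw [Finset.sum_comm]
  simp [quad, ind, dotProduct, mulVec, Finset.sum_ite_mem]

lemma quad_ind_singleton (i j : ι) : quad Ω (ind {i}) (ind {j}) = Ω i j := by
  simp [quad_ind]

lemma score_ind (S : Finset ι) (y : EuclideanSpace ℝ ι) :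
    score Ω (ind S) y = ∑ i ∈ S, score Ω (ind {i}) y := by
  simp [score, ind, dotProduct, Finset.sum_ite_mem]

lemma entry_le_one (hΩ : Ω.PosDef) (hd : ∀ i, Ω i i = 1) (i j : ι) : Ω i j ≤ 1 := by
  have h := quad_self_nonneg hΩ (ind {i} + (-1 : ℝ) • ind {j})
  simp only [quad_add_left, quad_add_right, quad_smul_left, quad_smul_right,
    quad_ind_singleton, hd, entry_comm hΩ j i] at h
  linarith

lemma Isolated.sum_le_one {S : Finset ι} (hS : Isolated Ω S) (hΩ : Ω.PosDef)
    (hd : ∀ i, Ω i i = 1) (j : ι) : ∑ i ∈ S, Ω i j ≤ 1 := by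
  by_cases h : ∃ i ∈ S, Ω i j ≠ 0
  · obtain ⟨i, hi, hij⟩ := h
    rw [Finset.sum_eq_single_of_mem i hi]
    · exact entry_le_one hΩ hd i j
    · intro k hk hki
      by_contra hkj
      rw [entry_comm hΩ] at hij hkj
      exact hki (hS j k hk i hi hkj hij)
  · push Not at h
    rw [Finset.sum_eq_zero h]
    exact zero_le_one

lemma Isolated.quad_eq_card {S J : Finset ι} (hS : Isolated Ω S) (hd : ∀ i, Ω i i = 1)
    (hJ : J ⊆ S) : quad Ω (ind S) (ind J) = J.card := by
  rw [quad_ind, Finset.sum_congr rfl fun j hj => hS.sum_eq_one hd (hJ hj)]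
  simp

omit [DecidableEq ι] in
lemma le_sum_sum_sum (s : ι → Finset ι) {f : ι → ι → ℝ} (hf : ∀ i j, 0 ≤ f i j) {i j k : ι}
    (hi : i ∈ s k) (hj : j ∈ s k) : f i j ≤ ∑ k, ∑ i ∈ s k, ∑ j ∈ s k, f i j :=
  calc f i j ≤ ∑ j ∈ s k, f i j := Finset.single_le_sum (fun j _ => hf i j) hj
    _ ≤ ∑ i ∈ s k, ∑ j ∈ s k, f i j := Finset.single_le_sum (f := fun i => ∑ j ∈ s k, f i j)
        (fun i _ => Finset.sum_nonneg fun j _ => hf i j) hi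
    _ ≤ _ := Finset.single_le_sum (f := fun k => ∑ i ∈ s k, ∑ j ∈ s k, f i j)
        (fun _ _ => Finset.sum_nonneg fun i _ => Finset.sum_nonneg fun j _ => hf i j)
        (Finset.mem_univ k)

/-- The set of signals fails to be isolated with probability at most `p d² ε²`, by a union bound
over the rows and over the pairs of nonzero entries of a row. -/
lemma sum_weight_not_isolated {ε : ℝ} (h0 : 0 ≤ ε) (h1 : ε ≤ 1) {d : ℕ}
    (hcard : ∀ i, (nbr Ω i).card ≤ d) :
    ∑ S, weight ε S * (if Isolated Ω S then 0 else 1) ≤ Fintype.card ι * (d : ℝ) ^ 2 * ε ^ 2 := by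
  have key (S : Finset ι) : (if Isolated Ω S then (0 : ℝ) else 1) ≤
      ∑ k, ∑ i ∈ nbr Ω k, ∑ j ∈ nbr Ω k,
        if i = j then 0 else if {i, j} ⊆ S then 1 else 0 := by
    have hnn (i j : ι) : (0 : ℝ) ≤ if i = j then 0 else if {i, j} ⊆ S then 1 else 0 := by
      split_ifs <;> norm_num
    split_ifs with h
    · exact Finset.sum_nonneg fun k _ => Finset.sum_nonneg fun i _ =>
        Finset.sum_nonneg fun j _ => hnn i j
    · simp only [Isolated, not_forall] at h
      obtain ⟨k, i, hi, j, hj, hki, hkj, hij⟩ := h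
      have hsub : {i, j} ⊆ S := by
        intro a ha
        simp only [Finset.mem_insert, Finset.mem_singleton] at ha
        rcases ha with rfl | rfl <;> assumption
      have h := le_sum_sum_sum (nbr Ω) hnn (mem_nbr.2 hki) (mem_nbr.2 hkj)
      rwa [if_neg hij, if_pos hsub] at h
  have pair (i j : ι) : ∑ S, weight ε S * (if i = j then 0 else if {i, j} ⊆ S then 1 else 0)
      ≤ ε ^ 2 := by
    by_cases hij : i = j
    · simp [hij, sq_nonneg]
    · simp only [if_neg hij]
      rw [sum_weight_subset, Finset.card_pair hij]
  calc ∑ S, weight ε S * (if Isolated Ω S then 0 else 1)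
      ≤ ∑ S, weight ε S * ∑ k, ∑ i ∈ nbr Ω k, ∑ j ∈ nbr Ω k,
        (if i = j then 0 else if {i, j} ⊆ S then 1 else 0) :=
        Finset.sum_le_sum fun S _ => mul_le_mul_of_nonneg_left (key S) (weight_nonneg h0 h1 S)
    _ = ∑ k, ∑ i ∈ nbr Ω k, ∑ j ∈ nbr Ω k,
        ∑ S, weight ε S * (if i = j then 0 else if {i, j} ⊆ S then 1 else 0) := by
        simp_rw [Finset.mul_sum]
        rw [Finset.sum_comm]
        refine Finset.sum_congr rfl fun k _ => ?_
        rw [Finset.sum_comm]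
        refine Finset.sum_congr rfl fun i _ => ?_
        rw [Finset.sum_comm]
    _ ≤ ∑ k, ∑ i ∈ nbr Ω k, ∑ j ∈ nbr Ω k, ε ^ 2 := by gcongr; exact pair _ _
    _ = ∑ k, ((nbr Ω k).card : ℝ) ^ 2 * ε ^ 2 := by
        simp only [Finset.sum_const, nsmul_eq_mul]
        refine Finset.sum_congr rfl fun k _ => by ring
    _ ≤ ∑ k : ι, (d : ℝ) ^ 2 * ε ^ 2 := by
        gcongr with k; exact_mod_cast hcard k
    _ = _ := by simp; ring

end Sparse

/-! ### The truncated likelihood ratio -/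

section Truncated

variable {ι : Type*} [Fintype ι] [DecidableEq ι] {Ω : Matrix ι ι ℝ}

/-- The event that none of the scores `(Ω y) i` at the indices `i ∈ S` exceeds `T`. -/
def below (Ω : Matrix ι ι ℝ) (T : ℝ) (S : Finset ι) : Set (EuclideanSpace ℝ ι) :=
  {y | ∀ i ∈ S, score Ω (ind {i}) y ≤ T}

lemma measurableSet_below (T : ℝ) (S : Finset ι) : MeasurableSet (below Ω T S) := by
  have : below Ω T S = ⋂ i ∈ S, {y | score Ω (ind {i}) y ≤ T} := by ext; simp [below]
  rw [this]
  exact Finset.measurableSet_biInter _ fun i _ => measurableSet_le (by fun_prop) (by fun_prop)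

/-- The likelihood ratio of the signal set `S`, truncated to the event `below Ω T S`. -/
def truncLik (Ω : Matrix ι ι ℝ) (τ T : ℝ) (S : Finset ι) : EuclideanSpace ℝ ι → ℝ :=
  (below Ω T S).indicator (lik Ω (τ • ind S))

lemma measurable_truncLik (τ T : ℝ) (S : Finset ι) : Measurable (truncLik Ω τ T S) :=
  (measurable_lik _).indicator (measurableSet_below T S)

lemma truncLik_nonneg (τ T : ℝ) (S : Finset ι) (y : EuclideanSpace ℝ ι) :
    0 ≤ truncLik Ω τ T S y := Set.indicator_nonneg (fun y _ => (lik_pos _ y).le) y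

lemma truncLik_le (τ T : ℝ) (S : Finset ι) (y : EuclideanSpace ℝ ι) :
    truncLik Ω τ T S y ≤ lik Ω (τ • ind S) y :=
  Set.indicator_le_self' (fun y _ => (lik_pos _ y).le) y

lemma integrable_truncLik (hΩ : Ω.PosDef) (τ T : ℝ) (S : Finset ι) :
    Integrable (truncLik Ω τ T S) (noise Ω) :=
  (integrable_lik hΩ _).indicator (measurableSet_below T S)

/-- The truncation removes little mass: each signal of an isolated set has a score distributed
as `N(τ, 1)`, which exceeds `T` with probability at most `exp (-(T - τ)² / 2)`. -/
lemma le_integral_truncLik (hΩ : Ω.PosDef) (hd : ∀ i, Ω i i = 1) {τ T : ℝ} (hT : τ ≤ T)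
    {S : Finset ι} (hS : Isolated Ω S) :
    1 - S.card * Real.exp (-(T - τ) ^ 2 / 2) ≤ ∫ y, truncLik Ω τ T S y ∂(noise Ω) := by
  set b := τ • ind S
  -- The multiplier `T - τ` is the one that optimizes the exponential Markov inequality.
  let F (i : ι) (y : EuclideanSpace ℝ ι) : ℝ :=
    Real.exp (score Ω (b + (T - τ) • ind {i}) y + (-(quad Ω b b / 2) - (T - τ) * T))
  have hF (i : ι) (y) : F i y = lik Ω b y * Real.exp ((T - τ) * (score Ω (ind {i}) y - T)) := by
    simp only [F, lik, ← Real.exp_add, score_add, score_smul]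
    congr 1; ring
  have hFint (i : ι) : Integrable (F i) (noise Ω) := integrable_exp_score hΩ _ _
  have hFval (i : ι) (hi : i ∈ S) : ∫ y, F i y ∂(noise Ω) = Real.exp (-(T - τ) ^ 2 / 2) := by
    rw [integral_exp_score hΩ]
    have h1 : quad Ω (ind S) (ind {i}) = 1 := by
      simpa using hS.quad_eq_card hd (Finset.singleton_subset_iff.2 hi)
    have h2 : quad Ω (ind {i}) (ind S) = 1 := by rw [quad_comm hΩ, h1]
    simp only [b, quad_add_left, quad_add_right, quad_smul_left, quad_smul_right,
      quad_ind_singleton, hd, h1, h2]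
    congr 1; ring
  have hle (y) : lik Ω b y - ∑ i ∈ S, F i y ≤ truncLik Ω τ T S y := by
    have hnn (i : ι) : 0 ≤ F i y := (Real.exp_pos _).le
    by_cases hy : y ∈ below Ω T S
    · rw [truncLik, Set.indicator_of_mem hy]
      linarith [Finset.sum_nonneg fun i (_ : i ∈ S) => hnn i]
    · rw [truncLik, Set.indicator_of_notMem hy]
      simp only [below, Set.mem_ofPred_eq, not_forall, not_le] at hy
      obtain ⟨i, hi, hiT⟩ := hy
      have h1 : F i y ≤ ∑ i ∈ S, F i y :=
        Finset.single_le_sum (f := fun i => F i y) (fun i _ => hnn i) hi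
      have h2 : lik Ω b y ≤ F i y := by
        rw [hF]
        refine le_mul_of_one_le_right (lik_pos _ _).le (Real.one_le_exp ?_)
        exact mul_nonneg (sub_nonneg.2 hT) (sub_nonneg.2 hiT.le)
      linarith
  calc 1 - S.card * Real.exp (-(T - τ) ^ 2 / 2)
      = ∫ y, (lik Ω b y - ∑ i ∈ S, F i y) ∂(noise Ω) := by
        rw [integral_sub (integrable_lik hΩ b) (integrable_finsetSum _ fun i _ => hFint i),
          integral_lik hΩ, integral_finsetSum _ fun i _ => hFint i,
          Finset.sum_congr rfl hFval]
        simp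
    _ ≤ _ := integral_mono ((integrable_lik hΩ b).sub
        (integrable_finsetSum _ fun i _ => hFint i)) (integrable_truncLik hΩ τ T S) hle

/-- The correlation of the truncated likelihood ratios of two isolated sets `S`, `S'` is at most
one factor `exp (τ² - λ² / 2)` for each element of `S'` that has a neighbour in `S`. Isolation
makes the neighbour unique, so that the exponent in the Gaussian integral splits over these
elements. -/
lemma integral_truncLik_mul_le (hΩ : Ω.PosDef) (hd : ∀ i, Ω i i = 1) {τ T lam : ℝ}
    (hτ : 0 ≤ τ) (hT : τ ≤ T) (hlam : lam = max (2 * τ - T) 0)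
    {S S' : Finset ι} (hS : Isolated Ω S) (hS' : Isolated Ω S') :
    Integrable (fun y => truncLik Ω τ T S y * truncLik Ω τ T S' y) (noise Ω) ∧
    ∫ y, truncLik Ω τ T S y * truncLik Ω τ T S' y ∂(noise Ω) ≤
      Real.exp (τ ^ 2 - lam ^ 2 / 2) ^ (S' ∩ S.biUnion (nbr Ω)).card := by
  set J := S' ∩ S.biUnion (nbr Ω) with hJ
  have hJS' : J ⊆ S' := Finset.inter_subset_left
  have hl0 : 0 ≤ lam := hlam ▸ le_max_right _ _
  have hlτ : lam ≤ τ := hlam ▸ max_le (by linarith) hτ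
  have hlam2 : lam * (T - 2 * τ) = -lam ^ 2 := by
    rw [hlam]
    rcases max_cases (2 * τ - T) 0 with ⟨h, _⟩ | ⟨h, _⟩ <;> rw [h] <;> ring
  let c : ℝ := lam * T * J.card - quad Ω (τ • ind S) (τ • ind S) / 2 -
    quad Ω (τ • ind S') (τ • ind S') / 2
  let G (y : EuclideanSpace ℝ ι) : ℝ :=
    Real.exp (score Ω (τ • ind S + τ • ind S' + (-lam) • ind J) y + c)
  have hGint : Integrable G (noise Ω) := integrable_exp_score hΩ _ _
  have hle (y) : truncLik Ω τ T S y * truncLik Ω τ T S' y ≤ G y := by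
    by_cases hy : y ∈ below Ω T S'
    · have h1 : truncLik Ω τ T S y * truncLik Ω τ T S' y ≤
          lik Ω (τ • ind S) y * lik Ω (τ • ind S') y :=
        mul_le_mul (truncLik_le _ _ _ _) (truncLik_le _ _ _ _) (truncLik_nonneg _ _ _ _)
          (lik_pos _ _).le
      refine h1.trans ?_
      rw [lik, lik, ← Real.exp_add]
      refine Real.exp_le_exp.2 ?_
      have h2 : score Ω (ind J) y ≤ T * J.card := by
        rw [score_ind]
        calc _ ≤ ∑ i ∈ J, T := Finset.sum_le_sum fun i hi => hy i (hJS' hi)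
          _ = _ := by simp [mul_comm]
      simp only [score_add, score_smul, c]
      nlinarith [mul_le_mul_of_nonneg_left h2 hl0]
    · rw [truncLik, truncLik, Set.indicator_of_notMem hy, mul_zero]
      exact (Real.exp_pos _).le
  have hnn (y) : 0 ≤ truncLik Ω τ T S y * truncLik Ω τ T S' y :=
    mul_nonneg (truncLik_nonneg _ _ _ _) (truncLik_nonneg _ _ _ _)
  have hint : Integrable (fun y => truncLik Ω τ T S y * truncLik Ω τ T S' y) (noise Ω) := by
    refine hGint.mono' ((measurable_truncLik τ T S).mul
      (measurable_truncLik τ T S')).aestronglyMeasurable (ae_of_all _ fun y => ?_)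
    rw [Real.norm_of_nonneg (hnn y)]
    exact hle y
  refine ⟨hint, (integral_mono hint hGint hle).trans ?_⟩
  rw [integral_exp_score hΩ, ← Real.exp_nat_mul]
  refine Real.exp_le_exp.2 ?_
  have q1 : quad Ω (ind S) (ind S') = quad Ω (ind S) (ind J) := by
    rw [quad_ind, quad_ind]
    refine (Finset.sum_subset hJS' fun j hj hjJ => Finset.sum_eq_zero fun i hi => ?_).symm
    by_contra h
    exact hjJ (Finset.mem_inter.2 ⟨hj, Finset.mem_biUnion.2 ⟨i, hi, mem_nbr.2 h⟩⟩)
  have q2 : quad Ω (ind S') (ind J) = J.card := hS'.quad_eq_card hd hJS'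
  have q3 : quad Ω (ind J) (ind J) = J.card := (hS'.mono hJS').quad_eq_card hd subset_rfl
  have q4 : quad Ω (ind S) (ind J) ≤ J.card := by
    rw [quad_ind]
    calc _ ≤ ∑ j ∈ J, (1 : ℝ) := Finset.sum_le_sum fun j _ => hS.sum_le_one hΩ hd j
      _ = _ := by simp
  simp only [c, quad_add_left, quad_add_right, quad_smul_left, quad_smul_right,
    quad_comm hΩ (ind J) (ind S), quad_comm hΩ (ind J) (ind S'), quad_comm hΩ (ind S') (ind S),
    q1, q2, q3]
  have h5 : (τ ^ 2 - lam * τ) * quad Ω (ind S) (ind J) ≤ (τ ^ 2 - lam * τ) * J.card :=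
    mul_le_mul_of_nonneg_left q4 (by nlinarith)
  have h6 : lam * (T - 2 * τ) * J.card = -lam ^ 2 * J.card := by rw [hlam2]
  linarith

end Truncated

/-! ### Total variation between the hypotheses -/

section Mixture

variable {ι : Type*} [Fintype ι] [DecidableEq ι] {Ω : Matrix ι ι ℝ}

/-- The truncated likelihood ratio of the alternative: the mixture of the truncated likelihood
ratios of the isolated sets of signals. -/
def mixLik (Ω : Matrix ι ι ℝ) (ε τ T : ℝ) (y : EuclideanSpace ℝ ι) : ℝ :=
  ∑ S with Isolated Ω S, weight ε S * truncLik Ω τ T S y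

lemma integrable_mixLik (hΩ : Ω.PosDef) (ε τ T : ℝ) :
    Integrable (mixLik Ω ε τ T) (noise Ω) :=
  integrable_finsetSum _ fun S _ => (integrable_truncLik hΩ τ T S).const_mul _

/-- The truncated likelihood ratio has almost full mass. -/
lemma le_integral_mixLik (hΩ : Ω.PosDef) (hd : ∀ i, Ω i i = 1) {d : ℕ}
    (hcard : ∀ i, (nbr Ω i).card ≤ d) {ε τ T : ℝ} (h0 : 0 ≤ ε) (h1 : ε ≤ 1) (hT : τ ≤ T) :
    1 - Fintype.card ι * (d : ℝ) ^ 2 * ε ^ 2 -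
      Fintype.card ι * ε * Real.exp (-(T - τ) ^ 2 / 2) ≤ ∫ y, mixLik Ω ε τ T y ∂(noise Ω) := by
  set q := Real.exp (-(T - τ) ^ 2 / 2)
  have hq : 0 ≤ q := (Real.exp_pos _).le
  calc _ ≤ ∑ S : Finset ι, weight ε S - ∑ S, weight ε S * (if Isolated Ω S then 0 else 1) -
        (∑ S : Finset ι, weight ε S * (S.card : ℝ)) * q := by
        rw [sum_weight, sum_weight_mul_card]
        linarith [sum_weight_not_isolated h0 h1 hcard]
    _ = ∑ S : Finset ι, weight ε S * ((1 - if Isolated Ω S then 0 else 1) - S.card * q) := by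
        rw [Finset.sum_mul, ← Finset.sum_sub_distrib, ← Finset.sum_sub_distrib]
        exact Finset.sum_congr rfl fun S _ => by ring
    _ ≤ ∑ S : Finset ι, if Isolated Ω S then
          weight ε S * ∫ y, truncLik Ω τ T S y ∂(noise Ω) else 0 := by
        refine Finset.sum_le_sum fun S _ => ?_
        have hw := weight_nonneg h0 h1 S
        split_ifs with hS
        · rw [sub_zero]
          exact mul_le_mul_of_nonneg_left (le_integral_truncLik hΩ hd hT hS) hw
        · exact mul_nonpos_of_nonneg_of_nonpos hw (by nlinarith [Nat.cast_nonneg (α := ℝ) S.card])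
    _ = _ := by
        rw [← Finset.sum_filter]
        simp only [mixLik]
        rw [integral_finsetSum _ fun S _ => (integrable_truncLik hΩ τ T S).const_mul _]
        simp_rw [integral_const_mul]

/-- The second moment of the truncated likelihood ratio. -/
lemma integral_mixLik_sq_le (hΩ : Ω.PosDef) (hd : ∀ i, Ω i i = 1) {d : ℕ}
    (hcard : ∀ i, (nbr Ω i).card ≤ d) {ε τ T lam : ℝ} (h0 : 0 ≤ ε) (h1 : ε ≤ 1) (hτ : 0 ≤ τ)
    (hT : τ ≤ T) (hlam : lam = max (2 * τ - T) 0) :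
    Integrable (fun y => mixLik Ω ε τ T y ^ 2) (noise Ω) ∧
    ∫ y, mixLik Ω ε τ T y ^ 2 ∂(noise Ω) ≤
      (1 + ε * ((1 + ε * Real.exp (τ ^ 2 - lam ^ 2 / 2)) ^ d - 1)) ^ Fintype.card ι := by
  set K := Real.exp (τ ^ 2 - lam ^ 2 / 2)
  have hK : 0 < K := Real.exp_pos _
  have hsq (y : EuclideanSpace ℝ ι) : mixLik Ω ε τ T y ^ 2 =
      ∑ S with Isolated Ω S, ∑ S' with Isolated Ω S',
        weight ε S * weight ε S' * (truncLik Ω τ T S y * truncLik Ω τ T S' y) := by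
    rw [sq, mixLik, Finset.sum_mul_sum]
    exact Finset.sum_congr rfl fun S _ => Finset.sum_congr rfl fun S' _ => by ring
  have hpair {S S' : Finset ι} (hS : S ∈ Finset.univ.filter (Isolated Ω))
      (hS' : S' ∈ Finset.univ.filter (Isolated Ω)) :=
    integral_truncLik_mul_le hΩ hd hτ hT hlam (Finset.mem_filter.1 hS).2 (Finset.mem_filter.1 hS').2
  have hint : ∀ S ∈ Finset.univ.filter (Isolated Ω), Integrable (fun y =>
      ∑ S' with Isolated Ω S',
        weight ε S * weight ε S' * (truncLik Ω τ T S y * truncLik Ω τ T S' y)) (noise Ω) :=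
    fun S hS => integrable_finsetSum _ fun S' hS' => (hpair hS hS').1.const_mul _
  simp_rw [hsq]
  refine ⟨integrable_finsetSum _ hint, ?_⟩
  rw [integral_finsetSum _ hint]
  calc _ = ∑ S with Isolated Ω S, ∑ S' with Isolated Ω S', weight ε S * weight ε S' *
        ∫ y, truncLik Ω τ T S y * truncLik Ω τ T S' y ∂(noise Ω) := by
        refine Finset.sum_congr rfl fun S hS => ?_
        rw [integral_finsetSum _ fun S' hS' => (hpair hS hS').1.const_mul _]
        simp_rw [integral_const_mul]
    _ ≤ ∑ S with Isolated Ω S, ∑ S' with Isolated Ω S', weight ε S * weight ε S' *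
        K ^ (S' ∩ S.biUnion (nbr Ω)).card := by
        refine Finset.sum_le_sum fun S hS => Finset.sum_le_sum fun S' hS' => ?_
        exact mul_le_mul_of_nonneg_left (hpair hS hS').2
          (mul_nonneg (weight_nonneg h0 h1 S) (weight_nonneg h0 h1 S'))
    _ ≤ ∑ S : Finset ι, ∑ S' : Finset ι, weight ε S * weight ε S' *
        K ^ (S' ∩ S.biUnion (nbr Ω)).card := by
        have hnn (S S' : Finset ι) : 0 ≤ weight ε S * weight ε S' *
            K ^ (S' ∩ S.biUnion (nbr Ω)).card :=
          mul_nonneg (mul_nonneg (weight_nonneg h0 h1 S) (weight_nonneg h0 h1 S'))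
            (pow_nonneg hK.le _)
        refine (Finset.sum_le_sum fun S _ => Finset.sum_le_sum_of_subset_of_nonneg
          (Finset.subset_univ _) fun S' _ _ => hnn S S').trans ?_
        exact Finset.sum_le_sum_of_subset_of_nonneg (Finset.subset_univ _) fun S _ _ =>
          Finset.sum_nonneg fun S' _ => hnn S S'
    _ = ∑ S : Finset ι, weight ε S * (1 + ε * (K - 1)) ^ (S.biUnion (nbr Ω)).card := by
        refine Finset.sum_congr rfl fun S _ => ?_
        rw [← sum_weight_mul_pow, Finset.mul_sum]
        exact Finset.sum_congr rfl fun S' _ => by ring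
    _ ≤ ∑ S : Finset ι, weight ε S * ((1 + ε * K) ^ d) ^ (S ∩ Finset.univ).card := by
        refine Finset.sum_le_sum fun S _ =>
          mul_le_mul_of_nonneg_left ?_ (weight_nonneg h0 h1 S)
        have hc : (S.biUnion (nbr Ω)).card ≤ d * S.card := by
          rw [mul_comm]
          exact Finset.card_biUnion_le_card_mul _ _ _ fun i _ => hcard i
        rw [← pow_mul, Finset.inter_univ]
        have hεK : 0 ≤ ε * K := mul_nonneg h0 hK.le
        exact (pow_le_pow_left₀ (by linarith) (by linarith) _).trans
          (pow_le_pow_right₀ (by linarith) hc)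
    _ = _ := by rw [sum_weight_mul_pow, Finset.card_univ]

end Mixture

/-- Every test has a sum of errors at least `1 - √(B - 2 m + 1)`, where `m` is a lower bound for
the mass of the truncated likelihood ratio and `B` an upper bound for its second moment. -/
lemma one_sub_sqrt_le_errors {ϑ r : ℝ} {p : ℕ} (hε : eps ϑ p ∈ Set.Icc (0 : ℝ) 1)
    {Ω : Matrix (Fin p) (Fin p) ℝ} (hΩ : Ω.PosDef) {T m B : ℝ}
    (hm : m ≤ ∫ y, mixLik Ω (eps ϑ p) (tau r p) T y ∂(noise Ω))
    (hint : Integrable (fun y => mixLik Ω (eps ϑ p) (tau r p) T y ^ 2) (noise Ω))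
    (hB : ∫ y, mixLik Ω (eps ϑ p) (tau r p) T y ^ 2 ∂(noise Ω) ≤ B)
    {φ : EuclideanSpace ℝ (Fin p) → ℝ} (hφ : IsTest φ) :
    1 - Real.sqrt (B - 2 * m + 1) ≤ typeI Ω φ + typeII ϑ r Ω φ := by
  set L := mixLik Ω (eps ϑ p) (tau r p) T with hL
  have hLi : Integrable L (noise Ω) := integrable_mixLik hΩ _ _ _
  have hφb (y) : |φ y| ≤ 1 := abs_le.2 ⟨by linarith [(hφ.2 y).1], (hφ.2 y).2⟩
  have hψb (y) : |1 - φ y| ≤ 1 :=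
    abs_le.2 ⟨by linarith [(hφ.2 y).2], by linarith [(hφ.2 y).1]⟩
  have hψm : Measurable fun y => 1 - φ y := measurable_const.sub hφ.1
  have hφi : Integrable φ (noise Ω) :=
    Integrable.of_bound hφ.1.aestronglyMeasurable 1 (ae_of_all _ hφb)
  have mulψ {g : EuclideanSpace ℝ (Fin p) → ℝ} (hg : Integrable g (noise Ω)) :
      Integrable (fun y => g y * (1 - φ y)) (noise Ω) :=
    hg.mul_bdd hψm.aestronglyMeasurable (ae_of_all _ hψb)
  have hII : ∫ y, L y * (1 - φ y) ∂(noise Ω) ≤ typeII ϑ r Ω φ := by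
    rw [typeII, integral_altLaw ϑ r hε hΩ hψm hψb]
    have h1 (y) : L y * (1 - φ y) = ∑ S with Isolated Ω S, weight (eps ϑ p) S *
        (truncLik Ω (tau r p) T S y * (1 - φ y)) := by
      rw [hL, mixLik, Finset.sum_mul]
      exact Finset.sum_congr rfl fun S _ => by ring
    simp_rw [h1]
    rw [integral_finsetSum _ fun S _ => (mulψ (integrable_truncLik hΩ _ _ _)).const_mul _]
    simp_rw [integral_const_mul]
    have hψ0 (y) : 0 ≤ 1 - φ y := by linarith [(hφ.2 y).2]
    refine (Finset.sum_le_sum fun S _ => mul_le_mul_of_nonneg_left (integral_mono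
      (mulψ (integrable_truncLik hΩ _ _ _)) (mulψ (integrable_lik hΩ _)) fun y =>
      mul_le_mul_of_nonneg_right (truncLik_le _ _ _ _) (hψ0 y))
      (weight_nonneg hε.1 hε.2 S)).trans ?_
    refine Finset.sum_le_sum_of_subset_of_nonneg (Finset.subset_univ _) fun S _ _ =>
      mul_nonneg (weight_nonneg hε.1 hε.2 S) (integral_nonneg fun y => ?_)
    exact mul_nonneg (lik_pos _ _).le (hψ0 y)
  have hI : typeI Ω φ = 1 - ∫ y, (1 - φ y) ∂(noise Ω) := by
    rw [typeI, nullLaw_eq, integral_sub (integrable_const _) hφi]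
    simp
  have hdiff : Integrable (fun y => L y - 1) (noise Ω) := hLi.sub (integrable_const _)
  have hsq : Integrable (fun y => (L y - 1) ^ 2) (noise Ω) := by
    refine ((hint.sub (hLi.const_mul 2)).add (integrable_const 1)).congr (ae_of_all _ fun y => ?_)
    simp only [Pi.sub_apply, Pi.add_apply]; ring
  have hvar : ∫ y, (L y - 1) ^ 2 ∂(noise Ω) ≤ B - 2 * m + 1 := by
    have h (y) : (L y - 1) ^ 2 = L y ^ 2 - 2 * L y + 1 := by ring
    simp_rw [h]
    have h2 : Integrable (fun y => L y ^ 2 - 2 * L y) (noise Ω) := hint.sub (hLi.const_mul 2)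
    rw [integral_add h2 (integrable_const _), integral_sub hint (hLi.const_mul 2), integral_const_mul]
    simp; linarith
  -- Jensen's inequality bounds the total variation by the chi-square distance.
  have hJ : (∫ y, |L y - 1| ∂(noise Ω)) ^ 2 ≤ ∫ y, (L y - 1) ^ 2 ∂(noise Ω) := by
    have hmem : MemLp (fun y => |L y - 1|) 2 (noise Ω) := by
      rw [memLp_two_iff_integrable_sq hdiff.abs.aestronglyMeasurable]
      simpa using hsq
    have := variance_nonneg (fun y => |L y - 1|) (noise Ω)
    rw [variance_eq_sub hmem] at this
    simpa using this
  have hTV : ∫ y, |L y - 1| ∂(noise Ω) ≤ Real.sqrt (B - 2 * m + 1) :=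
    Real.le_sqrt_of_sq_le (hJ.trans hvar)
  have hlow : -∫ y, |L y - 1| ∂(noise Ω) ≤ ∫ y, (L y - 1) * (1 - φ y) ∂(noise Ω) := by
    rw [← integral_neg]
    refine integral_mono hdiff.abs.neg (mulψ hdiff) fun y => ?_
    have h := neg_abs_le ((L y - 1) * (1 - φ y))
    rw [abs_mul] at h
    have := mul_le_of_le_one_right (abs_nonneg (L y - 1)) (hψb y)
    simp only
    linarith
  have hsplit : ∫ y, (L y - 1) * (1 - φ y) ∂(noise Ω) =
      ∫ y, L y * (1 - φ y) ∂(noise Ω) - ∫ y, (1 - φ y) ∂(noise Ω) := by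
    have hψi : Integrable (fun y => 1 - φ y) (noise Ω) := (integrable_const _).sub hφi
    rw [← integral_sub (mulψ hLi) hψi]
    simp_rw [sub_mul, one_mul]
  linarith

/-- Exchanging acceptance and rejection replaces the sum of errors `s` by `2 - s`. -/
lemma errors_one_sub {ϑ r : ℝ} {p : ℕ} (hε : eps ϑ p ∈ Set.Icc (0 : ℝ) 1)
    (Ω : Matrix (Fin p) (Fin p) ℝ) {φ : EuclideanSpace ℝ (Fin p) → ℝ} (hφ : IsTest φ) :
    typeI Ω (fun y => 1 - φ y) + typeII ϑ r Ω (fun y => 1 - φ y) =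
      2 - (typeI Ω φ + typeII ϑ r Ω φ) := by
  have h1 : IsProbabilityMeasure (nullLaw Ω) := by rw [nullLaw_eq]; infer_instance
  have h2 : IsProbabilityMeasure (altLaw ϑ r Ω) := by
    have : Fact (eps ϑ p ∈ Set.Icc (0 : ℝ) 1) := ⟨hε⟩
    have : IsProbabilityMeasure (signalLaw ϑ r p) :=
      Measure.isProbabilityMeasure_map (by fun_prop)
    exact Measure.isProbabilityMeasure_map (by fun_prop)
  have hφb (y) : |φ y| ≤ 1 := abs_le.2 ⟨by linarith [(hφ.2 y).1], (hφ.2 y).2⟩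
  have hi (μ : Measure (EuclideanSpace ℝ (Fin p))) [IsProbabilityMeasure μ] : Integrable φ μ :=
    Integrable.of_bound hφ.1.aestronglyMeasurable 1 (ae_of_all _ hφb)
  simp only [typeI, typeII, sub_sub_cancel]
  rw [integral_sub (integrable_const _) (hi _), integral_sub (integrable_const _) (hi _)]
  simp; ring

/-! ### Below the detection boundary -/

lemma card_nbr_le {p : ℕ} (Ω : Matrix (Fin p) (Fin p) ℝ) (i : Fin p) :
    (nbr Ω i).card ≤ maxRowNonzeros Ω := by
  classical
  have h := Finset.le_sup (f := fun i : Fin p =>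
    (Finset.univ.filter fun j : Fin p => Ω i j ≠ 0).card) (Finset.mem_univ i)
  unfold maxRowNonzeros nbr
  convert h

lemma eps_mem_Icc {ϑ : ℝ} (hϑ : 0 < ϑ) (p : ℕ) : eps ϑ p ∈ Set.Icc (0 : ℝ) 1 := by
  refine ⟨Real.rpow_nonneg (Nat.cast_nonneg p) _, ?_⟩
  rcases Nat.eq_zero_or_pos p with rfl | hp
  · simp [eps, Real.zero_rpow (neg_ne_zero.2 hϑ.ne')]
  · exact Real.rpow_le_one_of_one_le_of_nonpos (by exact_mod_cast hp) (by linarith)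

/-- The extreme level `√(2 log p)` of `p` standard normal variables. -/
def level (p : ℕ) : ℝ := Real.sqrt (2 * Real.log p)

lemma level_nonneg (p : ℕ) : 0 ≤ level p := Real.sqrt_nonneg _

lemma level_sq (p : ℕ) : level p ^ 2 = 2 * Real.log p :=
  Real.sq_sqrt (mul_nonneg zero_le_two (Real.log_natCast_nonneg p))

lemma tau_eq {r : ℝ} (hr : 0 ≤ r) (p : ℕ) : tau r p = Real.sqrt r * level p := by
  rw [tau, level, ← Real.sqrt_mul hr]
  congr 1; ring

lemma exp_mul_level_sq {p : ℕ} (hp : 0 < p) (c : ℝ) :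
    Real.exp (c * level p ^ 2 / 2) = (p : ℝ) ^ c := by
  rw [level_sq, Real.rpow_def_of_pos (by exact_mod_cast hp)]
  congr 1; ring

lemma tendsto_rpow_of_neg {c : ℝ} (hc : c < 0) :
    Tendsto (fun p : ℕ => (p : ℝ) ^ c) atTop (𝓝 0) := by
  have h := (tendsto_rpow_neg_atTop (neg_pos.2 hc)).comp (tendsto_natCast_atTop_atTop (R := ℝ))
  rw [neg_neg] at h
  exact h

/-- The exponent conditions behind the lower bound: below the boundary the expected number of
signals exceeding the extreme level vanishes, and so does the truncated second moment. -/
lemma exponents_of_lt_rhoStar {ϑ r : ℝ} (hϑ1 : ϑ < 1) (hr : 0 < r) (h : r < rhoStar ϑ) :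
    1 / 2 < ϑ ∧ Real.sqrt r < 1 ∧ 1 - ϑ - (1 - Real.sqrt r) ^ 2 < 0 ∧
      1 - 2 * ϑ + (2 * r - max (2 * Real.sqrt r - 1) 0 ^ 2) < 0 := by
  have hs0 : 0 < Real.sqrt r := Real.sqrt_pos.2 hr
  have hsr : Real.sqrt r ^ 2 = r := Real.sq_sqrt hr.le
  set s := Real.sqrt r
  unfold rhoStar at h
  split_ifs at h with h1 h2
  · linarith
  · push Not at h1
    have hs : s < 1 / 2 := by nlinarith
    refine ⟨h1, by linarith, by nlinarith [sq_nonneg (1 - 2 * s)], ?_⟩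
    rw [max_eq_right (by linarith)]
    linarith
  · push Not at h1 h2
    have hu0 : 0 < Real.sqrt (1 - ϑ) := Real.sqrt_pos.2 (by linarith)
    have huϑ : Real.sqrt (1 - ϑ) ^ 2 = 1 - ϑ := Real.sq_sqrt (by linarith)
    set u := Real.sqrt (1 - ϑ)
    have hu : u < 1 / 2 := by nlinarith
    have hsu : s < 1 - u := lt_of_pow_lt_pow_left₀ 2 (by linarith) (by linarith)
    refine ⟨h1, by linarith, by nlinarith, ?_⟩
    rcases le_total (2 * s - 1) 0 with h3 | h3
    · rw [max_eq_right h3]; nlinarith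
    · rw [max_eq_left h3]; nlinarith

lemma tendsto_maxRowNonzeros_mul_rpow {Ω : ∀ p : ℕ, Matrix (Fin p) (Fin p) ℝ}
    (hΩ : IsSparsePrecision Ω) {c : ℝ} (hc : c < 0) :
    Tendsto (fun p : ℕ => (maxRowNonzeros (Ω p) : ℝ) * (p : ℝ) ^ c) atTop (𝓝 0) := by
  simpa using hΩ.sparse (-c) (neg_pos.2 hc)

lemma tendsto_maxRowNonzeros_sq_mul_rpow {Ω : ∀ p : ℕ, Matrix (Fin p) (Fin p) ℝ}
    (hΩ : IsSparsePrecision Ω) {c : ℝ} (hc : c < 0) :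
    Tendsto (fun p : ℕ => (maxRowNonzeros (Ω p) : ℝ) ^ 2 * (p : ℝ) ^ c) atTop (𝓝 0) := by
  have h := (tendsto_maxRowNonzeros_mul_rpow hΩ (show c / 2 < 0 by linarith)).pow 2
  refine (h.congr fun p => ?_).trans (by simp)
  rw [mul_pow, ← Real.rpow_mul_natCast (Nat.cast_nonneg p)]
  congr 2; push_cast; ring

/-- Below the boundary, the sum of errors of every sequence of tests is asymptotically at
least `1`. -/
lemma exists_lower_bound_errors {ϑ r : ℝ} (hϑ0 : 0 < ϑ) (hϑ1 : ϑ < 1) (hr : 0 < r)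
    {Ω : ∀ p : ℕ, Matrix (Fin p) (Fin p) ℝ} (hΩ : IsSparsePrecision Ω) (h : r < rhoStar ϑ) :
    ∃ l : ℕ → ℝ, Tendsto l atTop (𝓝 1) ∧ ∀ᶠ p in atTop,
      ∀ φ : EuclideanSpace ℝ (Fin p) → ℝ, IsTest φ →
        l p ≤ typeI (Ω p) φ + typeII ϑ r (Ω p) φ := by
  obtain ⟨hϑ, hs1, hA, hκ⟩ := exponents_of_lt_rhoStar hϑ1 hr h
  set s := Real.sqrt r with hs
  have hsr : s ^ 2 = r := Real.sq_sqrt hr.le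
  have hs0 : 0 ≤ s := Real.sqrt_nonneg r
  set κ := 2 * r - max (2 * s - 1) 0 ^ 2 with hκdef
  let d (p : ℕ) : ℕ := maxRowNonzeros (Ω p)
  let m (p : ℕ) : ℝ := 1 - (d p : ℝ) ^ 2 * (p : ℝ) ^ (1 - 2 * ϑ) -
    (p : ℝ) ^ (1 - ϑ - (1 - s) ^ 2)
  let B (p : ℕ) : ℝ := Real.exp (2 * ((d p : ℝ) * (p : ℝ) ^ (1 - 2 * ϑ + κ)))
  have hm : Tendsto m atTop (𝓝 1) := by
    have h1 := tendsto_maxRowNonzeros_sq_mul_rpow hΩ (show 1 - 2 * ϑ < 0 by linarith)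
    simpa using (tendsto_const_nhds (x := (1 : ℝ))).sub h1 |>.sub (tendsto_rpow_of_neg hA)
  have hB : Tendsto B atTop (𝓝 1) := by
    have h1 := (tendsto_maxRowNonzeros_mul_rpow hΩ hκ).const_mul 2
    rw [mul_zero] at h1
    simpa [Function.comp_def] using (Real.continuous_exp.tendsto _).comp h1
  refine ⟨fun p => 1 - Real.sqrt (B p - 2 * m p + 1), ?_, ?_⟩
  · have h1 := ((hB.sub (hm.const_mul 2)).add_const 1).sqrt.const_sub 1
    refine h1.trans_eq ?_
    norm_num
  have hsmall : ∀ᶠ p : ℕ in atTop, (d p : ℝ) * (p : ℝ) ^ (κ - ϑ) ≤ 1 :=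
    (tendsto_maxRowNonzeros_mul_rpow hΩ (show κ - ϑ < 0 by linarith)).eventually_le_const one_pos
  filter_upwards [hsmall, eventually_gt_atTop 0] with p hdp hp φ hφ
  have hp' : (0 : ℝ) < p := by exact_mod_cast hp
  have hε := eps_mem_Icc hϑ0 p
  have hpos := hΩ.posDef p
  have hτ : tau r p = s * level p := tau_eq hr.le p
  have hl := level_nonneg p
  have hτ0 : 0 ≤ tau r p := Real.sqrt_nonneg _
  have hτT : tau r p ≤ level p := by rw [hτ]; nlinarith
  have hmean := le_integral_mixLik (T := level p) hpos (hΩ.diag p) (card_nbr_le (Ω p))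
    hε.1 hε.2 hτT
  obtain ⟨hint, hsq⟩ := integral_mixLik_sq_le (lam := max (2 * tau r p - level p) 0) hpos
    (hΩ.diag p) (card_nbr_le (Ω p)) hε.1 hε.2 hτ0 hτT rfl
  refine one_sub_sqrt_le_errors hε hpos ?_ hint (hsq.trans ?_) hφ
  · refine le_trans (le_of_eq ?_) hmean
    have e1 : Real.exp (-(level p - tau r p) ^ 2 / 2) = (p : ℝ) ^ (-(1 - s) ^ 2) := by
      rw [← exp_mul_level_sq hp, hτ]
      congr 1; ring
    have e2 : (p : ℝ) * eps ϑ p ^ 2 = (p : ℝ) ^ (1 - 2 * ϑ) := by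
      rw [eps, ← Real.rpow_mul_natCast hp'.le, ← Real.rpow_one_add' hp'.le]
      · congr 1; push_cast; ring
      · push_cast; linarith
    have e3 : (p : ℝ) * eps ϑ p * (p : ℝ) ^ (-(1 - s) ^ 2) =
        (p : ℝ) ^ (1 - ϑ - (1 - s) ^ 2) := by
      rw [eps]
      nth_rw 1 [← Real.rpow_one (p : ℝ)]
      rw [← Real.rpow_add hp', ← Real.rpow_add hp']
      congr 1
    rw [Fintype.card_fin, e1, e3]
    simp only [m, d]
    rw [← e2]; ring
  · have hlam : max (2 * tau r p - level p) 0 = max (2 * s - 1) 0 * level p := by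
      rw [max_mul_of_nonneg _ _ hl, hτ]
      congr 1 <;> ring
    have eK : Real.exp (tau r p ^ 2 - max (2 * tau r p - level p) 0 ^ 2 / 2) = (p : ℝ) ^ κ := by
      rw [← exp_mul_level_sq hp, hlam, hτ, hκdef, ← hsr]
      congr 1; ring
    rw [eK, Fintype.card_fin]
    have e4 : eps ϑ p * (p : ℝ) ^ κ = (p : ℝ) ^ (κ - ϑ) := by
      rw [eps, ← Real.rpow_add hp']; congr 1; ring
    rw [e4]
    set x := (p : ℝ) ^ (κ - ϑ) with hx
    have hx0 : 0 ≤ x := Real.rpow_nonneg hp'.le _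
    have hdx0 : 0 ≤ (d p : ℝ) * x := mul_nonneg (Nat.cast_nonneg _) hx0
    have h1 : (1 + x) ^ d p - 1 ≤ 2 * ((d p : ℝ) * x) := by
      have h2 : (1 + x) ^ d p ≤ Real.exp ((d p : ℝ) * x) := by
        rw [Real.exp_nat_mul]
        exact pow_le_pow_left₀ (by linarith) (by linarith [Real.add_one_le_exp x]) _
      have h3 := Real.abs_exp_sub_one_le (x := (d p : ℝ) * x) (by rwa [abs_of_nonneg hdx0])
      rw [abs_of_nonneg hdx0] at h3
      linarith [le_abs_self (Real.exp ((d p : ℝ) * x) - 1)]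
    have h0 : 0 ≤ (1 + x) ^ d p - 1 := by
      linarith [one_le_pow₀ (n := d p) (show (1 : ℝ) ≤ 1 + x by linarith)]
    calc (1 + eps ϑ p * ((1 + x) ^ d p - 1)) ^ p
        ≤ (Real.exp (eps ϑ p * (2 * ((d p : ℝ) * x)))) ^ p := by
          refine pow_le_pow_left₀ (by nlinarith [mul_nonneg hε.1 h0]) ?_ _
          linarith [Real.add_one_le_exp (eps ϑ p * (2 * ((d p : ℝ) * x))),
            mul_le_mul_of_nonneg_left h1 hε.1]
      _ = B p := by
          rw [← Real.exp_nat_mul]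
          simp only [B]
          congr 1
          have e5 : (p : ℝ) * eps ϑ p * x = (p : ℝ) ^ (1 - 2 * ϑ + κ) := by
            rw [eps, hx]
            nth_rw 1 [← Real.rpow_one (p : ℝ)]
            rw [← Real.rpow_add hp', ← Real.rpow_add hp']
            congr 1; ring
          rw [← e5]; ring

/-- Below the boundary, no sequence of tests does better, or worse, than guessing. -/
theorem tendsto_errors_of_lt_rhoStar {ϑ r : ℝ} (hϑ0 : 0 < ϑ) (hϑ1 : ϑ < 1) (hr : 0 < r)
    {Ω : ∀ p : ℕ, Matrix (Fin p) (Fin p) ℝ} (hΩ : IsSparsePrecision Ω) (h : r < rhoStar ϑ)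
    {φ : ∀ p : ℕ, EuclideanSpace ℝ (Fin p) → ℝ} (hφ : ∀ p, IsTest (φ p)) :
    Tendsto (fun p : ℕ => typeI (Ω p) (φ p) + typeII ϑ r (Ω p) (φ p)) atTop (𝓝 1) := by
  obtain ⟨l, hl, hle⟩ := exists_lower_bound_errors hϑ0 hϑ1 hr hΩ h
  have hl2 : Tendsto (fun p => 2 - l p) atTop (𝓝 1) := by
    have := hl.const_sub 2
    norm_num at this
    exact this
  refine tendsto_of_tendsto_of_tendsto_of_le_of_le' hl hl2 ?_ ?_
  · filter_upwards [hle] with p hp using hp _ (hφ p)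
  · filter_upwards [hle] with p hp
    have h1 : IsTest fun y => 1 - φ p y := ⟨measurable_const.sub (hφ p).1, fun y =>
      ⟨by linarith [((hφ p).2 y).2], by linarith [((hφ p).2 y).1]⟩⟩
    have h2 := hp _ h1
    rw [errors_one_sub (eps_mem_Icc hϑ0 p) (Ω p) (hφ p)] at h2
    linarith

/-! ### Gaussian tails -/

/-- The upper tail of the standard normal distribution. -/
def tail (c : ℝ) : ℝ := (gaussianReal 0 1).real (Set.Ioi c)

lemma tail_nonneg (c : ℝ) : 0 ≤ tail c := measureReal_nonneg

lemma tail_anti : Antitone tail := fun _ _ h => measureReal_mono (Set.Ioi_subset_Ioi h)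

lemma tail_le {c : ℝ} (hc : 0 ≤ c) : tail c ≤ Real.exp (-c ^ 2 / 2) := by
  have h := measure_ge_le_exp_mul_mgf (μ := gaussianReal 0 1) (X := id) c hc
    (integrable_exp_mul_gaussianReal c)
  rw [mgf_id_gaussianReal, ← Real.exp_add] at h
  refine (measureReal_mono fun x (hx : c < x) => hx.le).trans (h.trans_eq ?_)
  congr 1; push_cast; ring

lemma le_tail {a : ℝ} (ha : 0 ≤ a) {c : ℝ} (hc : c ≤ a) :
    Real.exp (-(a + 1) ^ 2 / 2) / 3 ≤ tail c := by
  have h1 : tail a = ∫ x in Set.Ioi a, gaussianPDFReal 0 1 x := by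
    rw [tail, measureReal_def, gaussianReal_apply_eq_integral _ one_ne_zero, ENNReal.toReal_ofReal]
    exact setIntegral_nonneg measurableSet_Ioi fun x _ => gaussianPDFReal_nonneg _ _ _
  have h2 : ∫ x in Set.Ioc a (a + 1), Real.exp (-(a + 1) ^ 2 / 2) / 3 ≤
      ∫ x in Set.Ioc a (a + 1), gaussianPDFReal 0 1 x := by
    refine setIntegral_mono_on (by simp) (integrable_gaussianPDFReal 0 1).integrableOn
      measurableSet_Ioc fun x hx => ?_
    have h3 : Real.sqrt (2 * Real.pi) ≤ 3 := by
      rw [Real.sqrt_le_left (by norm_num)]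
      linarith [Real.pi_lt_d2]
    have h4 : Real.exp (-(a + 1) ^ 2 / 2) ≤ Real.exp (-x ^ 2 / 2) :=
      Real.exp_le_exp.2 (by nlinarith [hx.1, hx.2])
    have h5 : 0 < Real.sqrt (2 * Real.pi) := by positivity
    rw [gaussianPDFReal, div_eq_inv_mul]
    simp only [NNReal.coe_one, mul_one, sub_zero]
    gcongr
  have h3 : ∫ x in Set.Ioc a (a + 1), gaussianPDFReal 0 1 x ≤
      ∫ x in Set.Ioi a, gaussianPDFReal 0 1 x :=
    setIntegral_mono_set (integrable_gaussianPDFReal 0 1).integrableOn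
      (ae_of_all _ fun x => gaussianPDFReal_nonneg _ _ _) Set.Ioc_subset_Ioi_self.eventuallyLE
  have h4 : ∫ x in Set.Ioc a (a + 1), Real.exp (-(a + 1) ^ 2 / 2) / 3 =
      Real.exp (-(a + 1) ^ 2 / 2) / 3 := by simp
  linarith [tail_anti hc]

/-! ### The number of exceedances -/

section Count

/-- The variance of the number of events that occur is at most `D` times its mean if each event
is independent of all but `D` of the others. -/
lemma variance_sum_indicator_le {α ι : Type*} [Fintype ι] {mα : MeasurableSpace α}
    (μ : Measure α) [IsProbabilityMeasure μ] {A : ι → Set α} (hA : ∀ i, MeasurableSet (A i))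
    (s : ι → Finset ι) {D : ℕ} (hs : ∀ i, (s i).card ≤ D)
    (hind : ∀ i, ∀ j ∉ s i, μ.real (A i ∩ A j) = μ.real (A i) * μ.real (A j)) :
    Var[fun x => ∑ i, (A i).indicator 1 x; μ] ≤ D * ∑ i, μ.real (A i) := by
  have hmem (i : ι) : MemLp ((A i).indicator (1 : α → ℝ)) 2 μ :=
    memLp_indicator_const 2 (hA i) 1 (Or.inr (measure_ne_top _ _))
  have hcov (i j : ι) : cov[(A i).indicator (1 : α → ℝ), (A j).indicator 1; μ] =
      μ.real (A i ∩ A j) - μ.real (A i) * μ.real (A j) := by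
    rw [covariance_eq_sub (hmem i) (hmem j), ← Set.inter_indicator_one,
      integral_indicator_one (hA i), integral_indicator_one (hA j),
      integral_indicator_one ((hA i).inter (hA j))]
  have hle (i j : ι) : μ.real (A i ∩ A j) - μ.real (A i) * μ.real (A j) ≤ μ.real (A i) := by
    linarith [measureReal_mono (μ := μ) (Set.inter_subset_left (s := A i) (t := A j)),
      mul_nonneg (measureReal_nonneg (μ := μ) (s := A i)) (measureReal_nonneg (μ := μ) (s := A j))]
  have hfun : (fun x => ∑ i, (A i).indicator (1 : α → ℝ) x) = ∑ i, (A i).indicator 1 := by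
    ext; simp
  rw [hfun, variance_sum hmem, Finset.mul_sum]
  refine Finset.sum_le_sum fun i _ => ?_
  simp_rw [hcov]
  calc ∑ j, (μ.real (A i ∩ A j) - μ.real (A i) * μ.real (A j))
      = ∑ j ∈ s i, (μ.real (A i ∩ A j) - μ.real (A i) * μ.real (A j)) :=
        (Finset.sum_subset (Finset.subset_univ _) fun j _ hj => by rw [hind i j hj, sub_self]).symm
    _ ≤ ∑ j ∈ s i, μ.real (A i) := Finset.sum_le_sum fun j _ => hle i j
    _ = (s i).card * μ.real (A i) := by simp
    _ ≤ D * μ.real (A i) :=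
        mul_le_mul_of_nonneg_right (by exact_mod_cast hs i) measureReal_nonneg

variable {p : ℕ} {Ω : Matrix (Fin p) (Fin p) ℝ}

/-- The law of the observation when each index carries a signal of strength `τ` independently
with probability `ε`. -/
def rareLaw (Ω : Matrix (Fin p) (Fin p) ℝ) (ε τ : ℝ) : Measure (EuclideanSpace ℝ (Fin p)) :=
  obsLaw Ω ((Measure.pi fun _ : Fin p => twoPoint ε τ).map (WithLp.toLp 2))

lemma altLaw_eq_rareLaw (ϑ r : ℝ) : altLaw ϑ r Ω = rareLaw Ω (eps ϑ p) (tau r p) := rfl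

lemma nullLaw_eq_rareLaw (τ : ℝ) : nullLaw Ω = rareLaw Ω 0 τ := by
  have h : twoPoint 0 τ = Measure.dirac 0 := by simp [twoPoint]
  have hpi : (Measure.pi fun _ : Fin p => Measure.dirac (0 : ℝ)) = Measure.dirac 0 := by
    refine Measure.pi_eq fun s hs => ?_
    simp_rw [Measure.dirac_apply' _ (hs _), Measure.dirac_apply' _ (MeasurableSet.univ_pi hs)]
    by_cases h : ∀ i, (0 : ℝ) ∈ s i
    · simp [Set.indicator, h]
    · have h' := h
      push Not at h'
      obtain ⟨i, hi⟩ := h'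
      rw [Finset.prod_eq_zero (Finset.mem_univ i) (by simp [hi])]
      simp [Set.indicator, h]
  have hmap : (Measure.dirac (0 : Fin p → ℝ)).map (WithLp.toLp 2) =
      Measure.dirac (0 : EuclideanSpace ℝ (Fin p)) :=
    Measure.map_dirac' (WithLp.measurable_toLp 2 _) 0
  rw [rareLaw, h, hpi, hmap, nullLaw]

instance (ε τ : ℝ) [Fact (ε ∈ Set.Icc (0 : ℝ) 1)] : IsProbabilityMeasure (rareLaw Ω ε τ) := by
  have : IsProbabilityMeasure
      ((Measure.pi fun _ : Fin p => twoPoint ε τ).map (WithLp.toLp 2)) :=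
    Measure.isProbabilityMeasure_map (by fun_prop)
  exact Measure.isProbabilityMeasure_map (by fun_prop)

/-- The event that the score `(Ω y) i` exceeds `t`. -/
def exceed (Ω : Matrix (Fin p) (Fin p) ℝ) (t : ℝ) (i : Fin p) : Set (EuclideanSpace ℝ (Fin p)) :=
  {y | t < score Ω (ind {i}) y}

lemma measurableSet_exceed (t : ℝ) (i : Fin p) : MeasurableSet (exceed Ω t i) :=
  measurableSet_lt measurable_const (measurable_score _)

lemma rareLaw_apply {ε τ : ℝ} [Fact (ε ∈ Set.Icc (0 : ℝ) 1)] {s : Set (EuclideanSpace ℝ (Fin p))}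
    (hs : MeasurableSet s) : rareLaw Ω ε τ s =
      ∫⁻ b, noise Ω {z | WithLp.toLp 2 b + z ∈ s} ∂(Measure.pi fun _ : Fin p => twoPoint ε τ) := by
  have hm : Measurable fun x : EuclideanSpace ℝ (Fin p) × EuclideanSpace ℝ (Fin p) =>
    x.1 + x.2 := by fun_prop
  rw [rareLaw, obsLaw, Measure.map_apply hm hs, Measure.prod_apply (hm hs),
    lintegral_map (measurable_measure_prodMk_left (hm hs)) (by fun_prop)]
  rfl

lemma quad_ind_left (i : Fin p) (b : Fin p → ℝ) :
    quad Ω (ind {i}) b = ∑ j ∈ nbr Ω i, Ω i j * b j := by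
  have h : quad Ω (ind {i}) b = ∑ j, Ω i j * b j := by
    simp [quad, ind, dotProduct, Matrix.mulVec]
  rw [h]
  refine (Finset.sum_subset (Finset.subset_univ _) fun j _ hj => ?_).symm
  have : Ω i j = 0 := by simpa using hj
  simp [this]

lemma noise_score_gt (hΩ : Ω.PosDef) (hd : ∀ i, Ω i i = 1) (i : Fin p) (c : ℝ) :
    noise Ω {z | c < score Ω (ind {i}) z} = gaussianReal 0 1 (Set.Ioi c) := by
  have h := map_score hΩ (ind {i})
  rw [quad_ind_singleton, hd, Real.toNNReal_one] at h
  rw [← h, Measure.map_apply (by fun_prop) measurableSet_Ioi]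
  rfl

lemma measurable_gaussianReal_Ioi :
    Measurable fun c => gaussianReal 0 1 (Set.Ioi c) :=
  Antitone.measurable fun _ _ h => measure_mono (Set.Ioi_subset_Ioi h)

lemma measurable_conditional_exceed (t : ℝ) (i : Fin p) :
    Measurable fun b : Fin p → ℝ => gaussianReal 0 1 (Set.Ioi (t - quad Ω (ind {i}) b)) := by
  refine measurable_gaussianReal_Ioi.comp ?_
  simp_rw [quad_ind_left]
  fun_prop

lemma rareLaw_exceed (hΩ : Ω.PosDef) (hd : ∀ i, Ω i i = 1) {ε τ : ℝ}
    [Fact (ε ∈ Set.Icc (0 : ℝ) 1)] (t : ℝ) (i : Fin p) :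
    rareLaw Ω ε τ (exceed Ω t i) = ∫⁻ b, gaussianReal 0 1 (Set.Ioi (t - quad Ω (ind {i}) b))
      ∂(Measure.pi fun _ : Fin p => twoPoint ε τ) := by
  rw [rareLaw_apply (measurableSet_exceed t i)]
  refine lintegral_congr fun b => ?_
  rw [← noise_score_gt hΩ hd i]
  congr 1
  ext z
  simp [exceed, score_add_right, score_toLp, sub_lt_iff_lt_add']

/-- Exceedances at indices whose rows have disjoint supports are independent: the noise parts of
the two scores are uncorrelated, and their signal parts involve disjoint sets of indices. -/
lemma rareLaw_exceed_inter (hΩ : Ω.PosDef) (hd : ∀ i, Ω i i = 1) {ε τ : ℝ}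
    [Fact (ε ∈ Set.Icc (0 : ℝ) 1)] (t : ℝ) {i j : Fin p} (hij : Disjoint (nbr Ω i) (nbr Ω j)) :
    rareLaw Ω ε τ (exceed Ω t i ∩ exceed Ω t j) =
      rareLaw Ω ε τ (exceed Ω t i) * rareLaw Ω ε τ (exceed Ω t j) := by
  have h0 : quad Ω (ind {i}) (ind {j}) = 0 := by
    rw [quad_ind_singleton]
    by_contra h
    exact Finset.disjoint_left.1 hij (mem_nbr.2 h) (mem_nbr.2 (by simp [hd]))
  have hz := indepFun_score hΩ h0
  rw [rareLaw_exceed hΩ hd, rareLaw_exceed hΩ hd,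
    rareLaw_apply ((measurableSet_exceed t i).inter (measurableSet_exceed t j))]
  have hprod (b : Fin p → ℝ) :
      noise Ω {z | WithLp.toLp 2 b + z ∈ exceed Ω t i ∩ exceed Ω t j} =
      gaussianReal 0 1 (Set.Ioi (t - quad Ω (ind {i}) b)) *
        gaussianReal 0 1 (Set.Ioi (t - quad Ω (ind {j}) b)) := by
    rw [← noise_score_gt hΩ hd i, ← noise_score_gt hΩ hd j]
    have := hz.measure_inter_preimage_eq_mul (Set.Ioi (t - quad Ω (ind {i}) b))
      (Set.Ioi (t - quad Ω (ind {j}) b)) measurableSet_Ioi measurableSet_Ioi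
    refine Eq.trans ?_ this
    congr 1
    ext z
    simp [exceed, score_add_right, score_toLp, sub_lt_iff_lt_add']
  simp_rw [hprod]
  have hb : iIndepFun (fun (k : Fin p) (b : Fin p → ℝ) => b k)
      (Measure.pi fun _ : Fin p => twoPoint ε τ) :=
    iIndepFun_pi (X := fun _ x => x) fun _ => aemeasurable_id
  have hb2 := hb.indepFun_finset _ _ hij fun k => measurable_pi_apply k
  have hg (k : Fin p) : Measurable fun v : nbr Ω k → ℝ =>
      gaussianReal 0 1 (Set.Ioi (t - ∑ l : nbr Ω k, Ω k l * v l)) :=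
    measurable_gaussianReal_Ioi.comp (by fun_prop)
  have hb3 := hb2.comp (hg i) (hg j)
  have hfun (k : Fin p) : (fun b : Fin p → ℝ =>
      gaussianReal 0 1 (Set.Ioi (t - quad Ω (ind {k}) b))) =
      (fun v : nbr Ω k → ℝ => gaussianReal 0 1 (Set.Ioi (t - ∑ l : nbr Ω k, Ω k l * v l))) ∘
        fun b l => b l := by
    ext b
    simp only [Function.comp, quad_ind_left]
    rw [← Finset.sum_coe_sort]
  rw [← hfun, ← hfun] at hb3
  exact lintegral_mul_eq_lintegral_mul_lintegral_of_indepFun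
    (measurable_conditional_exceed t i) (measurable_conditional_exceed t j) hb3

lemma rareLaw_real_exceed (hΩ : Ω.PosDef) (hd : ∀ i, Ω i i = 1) {ε τ : ℝ}
    [hε : Fact (ε ∈ Set.Icc (0 : ℝ) 1)] (t : ℝ) (i : Fin p) :
    (rareLaw Ω ε τ).real (exceed Ω t i) =
      ∑ S, weight ε S * tail (t - τ * ∑ j ∈ S, Ω i j) := by
  rw [measureReal_def, rareLaw_exceed hΩ hd, pi_twoPoint ε τ hε.out, lintegral_finsetSum_measure,
    ENNReal.toReal_sum]
  · refine Finset.sum_congr rfl fun S _ => ?_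
    rw [lintegral_smul_measure, lintegral_dirac' _ (measurable_conditional_exceed t i), smul_eq_mul,
      ENNReal.toReal_mul, ENNReal.toReal_ofReal (weight_nonneg hε.out.1 hε.out.2 S), tail,
      measureReal_def, quad_smul_right]
    have : quad Ω (ind {i}) (ind S) = ∑ j ∈ S, Ω i j := by simp [quad_ind]
    rw [this]
  · intro S _
    rw [lintegral_smul_measure, lintegral_dirac' _ (measurable_conditional_exceed t i)]
    exact (ENNReal.mul_lt_top (by simp) (measure_lt_top _ _)).ne

end Count

/-! ### The test that counts exceedances -/

section Detection

variable {p : ℕ} {Ω : Matrix (Fin p) (Fin p) ℝ}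

/-- The exceedance probability at `i` is at least the contributions of the two events that the
support of row `i` carries no signal, and that it carries a signal at `i` only. -/
lemma le_rareLaw_real_exceed (hΩ : Ω.PosDef) (hd : ∀ i, Ω i i = 1) {d : ℕ}
    (hcard : ∀ i, (nbr Ω i).card ≤ d) {ε τ : ℝ} [hε : Fact (ε ∈ Set.Icc (0 : ℝ) 1)]
    (t : ℝ) (i : Fin p) :
    (1 - d * ε) * tail t + ε * (1 - d * ε) * tail (t - τ) ≤
      (rareLaw Ω ε τ).real (exceed Ω t i) := by
  obtain ⟨h0, h1⟩ := hε.out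
  rw [rareLaw_real_exceed hΩ hd]
  set N := nbr Ω i with hN
  have hiN : i ∈ N := mem_nbr.2 (by simp [hd])
  let u (S : Finset (Fin p)) : ℝ := ∏ k, if k ∈ S then (if k ∈ N then 0 else 1) else 1
  let v (S : Finset (Fin p)) : ℝ :=
    ∏ k, if k ∈ S then (if k ∈ N.erase i then 0 else 1) else (if k = i then 0 else 1)
  have hpow {n : ℕ} (hn : n ≤ d) : 1 - d * ε ≤ (1 - ε) ^ n := by
    have h := one_add_mul_le_pow (show -2 ≤ -ε by linarith) n
    have hn' : (n : ℝ) * ε ≤ d * ε := mul_le_mul_of_nonneg_right (by exact_mod_cast hn) h0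
    calc _ ≤ 1 + (n : ℝ) * -ε := by linarith
      _ ≤ _ := h
  have hu : 1 - d * ε ≤ ∑ S, weight ε S * u S := by
    have h : ∑ S, weight ε S * u S = (1 - ε) ^ N.card := by
      rw [sum_weight_mul_prod ε (fun k => if k ∈ N then 0 else 1) fun _ => 1,
        ← Finset.prod_const, ← Finset.prod_subset (Finset.subset_univ N)]
      · exact Finset.prod_congr rfl fun k hk => by simp [hk]
      · intro k _ hk; simp [hk]
    rw [h]
    exact hpow (hcard i)
  have hv : ε * (1 - d * ε) ≤ ∑ S, weight ε S * v S := by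
    have h : ∑ S, weight ε S * v S = ε * (1 - ε) ^ (N.erase i).card := by
      rw [sum_weight_mul_prod ε (fun k => if k ∈ N.erase i then 0 else 1)
        fun k => if k = i then 0 else 1, ← Finset.mul_prod_erase _ _ (Finset.mem_univ i)]
      congr 1
      · simp
      · rw [← Finset.prod_const, ← Finset.prod_subset
          (Finset.erase_subset_erase i (Finset.subset_univ N))]
        · refine Finset.prod_congr rfl fun k hk => ?_
          rw [if_pos hk, if_neg (Finset.mem_erase.1 hk).1]; ring
        · intro k hk hk'
          rw [if_neg hk', if_neg (Finset.mem_erase.1 hk).1]; ring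
    rw [h]
    exact mul_le_mul_of_nonneg_left (hpow ((Finset.card_erase_le).trans (hcard i))) h0
  have hzero {k : Fin p} (hk : k ∉ N) : Ω i k = 0 := by simpa [hN] using hk
  have hpt (S : Finset (Fin p)) :
      u S * tail t + v S * tail (t - τ) ≤ tail (t - τ * ∑ j ∈ S, Ω i j) := by
    by_cases hS : ∃ k ∈ S, k ∈ N.erase i
    · obtain ⟨k, hkS, hk⟩ := hS
      have hu0 : u S = 0 := Finset.prod_eq_zero (Finset.mem_univ k)
        (by simp [hkS, Finset.mem_of_mem_erase hk])
      have hv0 : v S = 0 := Finset.prod_eq_zero (Finset.mem_univ k) (by rw [if_pos hkS, if_pos hk])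
      rw [hu0, hv0]
      simpa using tail_nonneg _
    · push Not at hS
      have hu1 : u S ≤ 1 := Finset.prod_le_one (fun k _ => by split_ifs <;> norm_num)
        fun k _ => by split_ifs <;> norm_num
      have hv1 : v S ≤ 1 := Finset.prod_le_one (fun k _ => by split_ifs <;> norm_num)
        fun k _ => by split_ifs <;> norm_num
      have hz {k : Fin p} (hk : k ∈ S) (hki : k ≠ i) : Ω i k = 0 :=
        hzero fun h => hS k hk (Finset.mem_erase.2 ⟨hki, h⟩)
      by_cases hi : i ∈ S
      · have hu0 : u S = 0 := Finset.prod_eq_zero (Finset.mem_univ i) (by simp [hi, hiN])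
        have hsum : ∑ j ∈ S, Ω i j = 1 := by
          rw [Finset.sum_eq_single_of_mem i hi fun k hk hki => hz hk hki, hd]
        rw [hu0, hsum, mul_one, zero_mul, zero_add]
        exact mul_le_of_le_one_left (tail_nonneg _) hv1
      · have hv0 : v S = 0 := Finset.prod_eq_zero (Finset.mem_univ i) (by simp [hi])
        have hsum : ∑ j ∈ S, Ω i j = 0 :=
          Finset.sum_eq_zero fun k hk => hz hk fun h => hi (h ▸ hk)
        rw [hv0, hsum, mul_zero, sub_zero, zero_mul, add_zero]
        exact mul_le_of_le_one_left (tail_nonneg _) hu1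
  calc (1 - d * ε) * tail t + ε * (1 - d * ε) * tail (t - τ)
      ≤ (∑ S, weight ε S * u S) * tail t + (∑ S, weight ε S * v S) * tail (t - τ) :=
        add_le_add (mul_le_mul_of_nonneg_right hu (tail_nonneg _))
          (mul_le_mul_of_nonneg_right hv (tail_nonneg _))
    _ = ∑ S, weight ε S * (u S * tail t + v S * tail (t - τ)) := by
        rw [Finset.sum_mul, Finset.sum_mul, ← Finset.sum_add_distrib]
        exact Finset.sum_congr rfl fun S _ => by ring
    _ ≤ _ := Finset.sum_le_sum fun S _ =>
        mul_le_mul_of_nonneg_left (hpt S) (weight_nonneg h0 h1 S)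

lemma nullLaw_real_exceed (hΩ : Ω.PosDef) (hd : ∀ i, Ω i i = 1) (t : ℝ) (i : Fin p) :
    (nullLaw Ω).real (exceed Ω t i) = tail t := by
  rw [nullLaw_eq, measureReal_def, exceed, noise_score_gt hΩ hd, tail, measureReal_def]

/-- The number of indices `i` whose score `(Ω y) i` exceeds `t`. -/
def exceedCount (Ω : Matrix (Fin p) (Fin p) ℝ) (t : ℝ) (y : EuclideanSpace ℝ (Fin p)) : ℝ :=
  ∑ i, (exceed Ω t i).indicator 1 y

lemma measurable_exceedCount (t : ℝ) : Measurable (exceedCount Ω t) :=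
  Finset.measurable_sum _ fun i _ => measurable_one.indicator (measurableSet_exceed t i)

/-- Chebyshev's inequality for the number of exceedances. An exceedance at `i` is independent of
the one at `j` unless `j` is a neighbour of a neighbour of `i`. -/
lemma rareLaw_real_deviation_le (hΩ : Ω.PosDef) (hd : ∀ i, Ω i i = 1) {d : ℕ}
    (hcard : ∀ i, (nbr Ω i).card ≤ d) (ε τ : ℝ) [Fact (ε ∈ Set.Icc (0 : ℝ) 1)] (t : ℝ) {c : ℝ}
    (hc : 0 < c) :
    (rareLaw Ω ε τ).real
      {y | c ≤ |exceedCount Ω t y - ∑ i, (rareLaw Ω ε τ).real (exceed Ω t i)|} ≤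
      (d : ℝ) ^ 2 * (∑ i, (rareLaw Ω ε τ).real (exceed Ω t i)) / c ^ 2 := by
  set μ := rareLaw Ω ε τ
  have hmem (i : Fin p) : MemLp ((exceed Ω t i).indicator (1 : EuclideanSpace ℝ (Fin p) → ℝ)) 2 μ :=
    memLp_indicator_const 2 (measurableSet_exceed t i) 1 (Or.inr (measure_ne_top _ _))
  have hN : MemLp (exceedCount Ω t) 2 μ := memLp_finsetSum _ fun i _ => hmem i
  have hmean : μ[exceedCount Ω t] = ∑ i, μ.real (exceed Ω t i) := by
    simp only [exceedCount]
    rw [integral_finsetSum _ fun i _ => (hmem i).integrable (by norm_num)]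
    exact Finset.sum_congr rfl fun i _ => integral_indicator_one (measurableSet_exceed t i)
  have hvar : Var[exceedCount Ω t; μ] ≤ (d : ℝ) ^ 2 * ∑ i, μ.real (exceed Ω t i) := by
    have h := variance_sum_indicator_le μ (fun i => measurableSet_exceed (Ω := Ω) t i)
      (fun i => (nbr Ω i).biUnion (nbr Ω)) (D := d * d)
      (fun i => (Finset.card_biUnion_le_card_mul _ _ d fun k _ => hcard k).trans
        (Nat.mul_le_mul_right _ (hcard i))) fun i j hj => by
        rw [measureReal_def, rareLaw_exceed_inter hΩ hd, ENNReal.toReal_mul]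
        · rfl
        · refine Finset.disjoint_left.2 fun k hki hkj => hj ?_
          rw [mem_nbr, entry_comm hΩ] at hkj
          exact Finset.mem_biUnion.2 ⟨k, hki, mem_nbr.2 hkj⟩
    push_cast at h
    rw [sq]
    exact h
  have h := meas_ge_le_variance_div_sq hN hc
  rw [hmean] at h
  refine (ENNReal.toReal_mono ENNReal.ofReal_ne_top h).trans ?_
  rw [ENNReal.toReal_ofReal (div_nonneg (variance_nonneg _ _) (sq_nonneg c))]
  gcongr

/-- The test that rejects when the number of exceedances of `t` is more than `c`. -/
def countTest (Ω : Matrix (Fin p) (Fin p) ℝ) (t c : ℝ) : EuclideanSpace ℝ (Fin p) → ℝ :=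
  {y | c < exceedCount Ω t y}.indicator 1

lemma measurableSet_reject (t c : ℝ) : MeasurableSet {y | c < exceedCount Ω t y} :=
  measurableSet_lt measurable_const (measurable_exceedCount t)

lemma isNonrandomizedTest_countTest (t c : ℝ) : IsNonrandomizedTest (countTest Ω t c) := by
  have h (y) : countTest Ω t c y = 0 ∨ countTest Ω t c y = 1 :=
    Set.indicator_eq_zero_or_self _ _ _
  refine ⟨⟨measurable_one.indicator (measurableSet_reject t c), fun y => ?_⟩, h⟩
  rcases h y with h | h <;> rw [h] <;> norm_num

/-- If signals raise the mean number of exceedances by at least `g`, the test that puts its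
critical value `g / 2` above the null mean has errors controlled by Chebyshev's inequality. -/
lemma errors_countTest_le (hΩ : Ω.PosDef) (hd : ∀ i, Ω i i = 1) {d : ℕ}
    (hcard : ∀ i, (nbr Ω i).card ≤ d) {ϑ r : ℝ} (hε : eps ϑ p ∈ Set.Icc (0 : ℝ) 1) (t : ℝ) {g : ℝ}
    (hg : 0 < g) (hgap : p * tail t + g ≤ ∑ i, (altLaw ϑ r Ω).real (exceed Ω t i)) :
    typeI Ω (countTest Ω t (p * tail t + g / 2)) +
      typeII ϑ r Ω (countTest Ω t (p * tail t + g / 2)) ≤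
      4 * (d : ℝ) ^ 2 * (2 * (p * tail t / g ^ 2) + 1 / g) := by
  have : Fact (eps ϑ p ∈ Set.Icc (0 : ℝ) 1) := ⟨hε⟩
  have : Fact ((0 : ℝ) ∈ Set.Icc (0 : ℝ) 1) := ⟨by simp⟩
  have hprob : IsProbabilityMeasure (altLaw ϑ r Ω) := by
    rw [altLaw_eq_rareLaw]; infer_instance
  set E := p * tail t with hE
  have hE0 : 0 ≤ E := mul_nonneg (Nat.cast_nonneg _) (tail_nonneg _)
  set c := E + g / 2 with hc
  have hI : typeI Ω (countTest Ω t c) ≤ (d : ℝ) ^ 2 * E / (g / 2) ^ 2 := by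
    have h := rareLaw_real_deviation_le hΩ hd hcard 0 0 t (half_pos hg)
    rw [← nullLaw_eq_rareLaw] at h
    simp only [nullLaw_real_exceed hΩ hd, Finset.sum_const, Finset.card_univ, Fintype.card_fin,
      nsmul_eq_mul, ← hE] at h
    rw [typeI, countTest, integral_indicator_one (measurableSet_reject t c)]
    have : IsProbabilityMeasure (nullLaw Ω) := by rw [nullLaw_eq]; infer_instance
    refine (measureReal_mono fun y hy => ?_).trans h
    have hy' : c < exceedCount Ω t y := hy
    change g / 2 ≤ |exceedCount Ω t y - E|
    exact le_abs.2 (Or.inl (by linarith))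
  set A := ∑ i, (altLaw ϑ r Ω).real (exceed Ω t i) with hA
  have hII : typeII ϑ r Ω (countTest Ω t c) ≤ (d : ℝ) ^ 2 * A / ((A - E) / 2) ^ 2 := by
    have h := rareLaw_real_deviation_le hΩ hd hcard (eps ϑ p) (tau r p) t
      (c := (A - E) / 2) (by linarith)
    rw [← altLaw_eq_rareLaw, ← hA] at h
    have hcompl : (fun y => 1 - countTest Ω t c y) =
        {y | c < exceedCount Ω t y}ᶜ.indicator 1 := by
      ext y
      by_cases hy : y ∈ {y | c < exceedCount Ω t y} <;> simp [countTest, hy]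
    rw [typeII, hcompl, integral_indicator_one (measurableSet_reject t c).compl]
    refine (measureReal_mono fun y hy => ?_).trans h
    have hy' : ¬ c < exceedCount Ω t y := hy
    push Not at hy'
    change (A - E) / 2 ≤ |exceedCount Ω t y - A|
    exact le_abs.2 (Or.inr (by linarith))
  have hΔ : g ≤ A - E := by linarith
  have hII' : (d : ℝ) ^ 2 * A / ((A - E) / 2) ^ 2 ≤ 4 * (d : ℝ) ^ 2 * (E / g ^ 2 + 1 / g) := by
    have e : (d : ℝ) ^ 2 * A / ((A - E) / 2) ^ 2 =
        4 * (d : ℝ) ^ 2 * (E / (A - E) ^ 2 + 1 / (A - E)) := by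
      have : A - E ≠ 0 := by linarith
      field_simp; ring
    rw [e]
    gcongr
  have hI' : (d : ℝ) ^ 2 * E / (g / 2) ^ 2 = 4 * (d : ℝ) ^ 2 * (E / g ^ 2) := by
    field_simp; ring
  linarith

end Detection

/-! ### Above the detection boundary -/

/-- Above the boundary there is a level `σ √(2 log p)` at which the number of exceedances by
signals is large, and large compared with the standard deviation of the number under the null. -/
lemma exists_exponent_of_rhoStar_lt {ϑ r : ℝ} (hϑ1 : ϑ < 1) (hr : 0 < r)
    (h : rhoStar ϑ < r) :
    ∃ σ : ℝ, 0 < σ ∧ max (σ - Real.sqrt r) 0 ^ 2 < σ ^ 2 ∧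
      max (σ - Real.sqrt r) 0 ^ 2 < 1 - ϑ ∧
      2 * ϑ + 2 * max (σ - Real.sqrt r) 0 ^ 2 < 1 + σ ^ 2 := by
  have hs0 : 0 < Real.sqrt r := Real.sqrt_pos.2 hr
  have hsr : Real.sqrt r ^ 2 = r := Real.sq_sqrt hr.le
  set s := Real.sqrt r
  have hϑ : (ϑ ≤ 1 / 2) ∨ (1 / 2 < ϑ ∧ ϑ ≤ 3 / 4 ∧ ϑ - 1 / 2 < s ^ 2) ∨
      (3 / 4 < ϑ ∧ 1 - Real.sqrt (1 - ϑ) < s) := by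
    unfold rhoStar at h
    split_ifs at h with h1 h2
    · exact Or.inl h1
    · exact Or.inr (Or.inl ⟨not_le.1 h1, h2, by rw [hsr]; exact h⟩)
    · refine Or.inr (Or.inr ⟨not_le.1 h2, lt_of_pow_lt_pow_left₀ 2 hs0.le ?_⟩)
      rw [hsr]; exact h
  have hu0 : 0 < Real.sqrt (1 - ϑ) := Real.sqrt_pos.2 (by linarith)
  have huϑ : Real.sqrt (1 - ϑ) ^ 2 = 1 - ϑ := Real.sq_sqrt (by linarith)
  set u := Real.sqrt (1 - ϑ)
  rcases lt_or_ge s (1 / 2) with hs | hs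
  -- Weak signals are best detected at twice their strength.
  · refine ⟨2 * s, by linarith, ?_⟩
    rw [show 2 * s - s = s by ring, max_eq_left hs0.le]
    refine ⟨by nlinarith, ?_, ?_⟩
    · rcases hϑ with h | ⟨_, h, _⟩ | ⟨h, h'⟩ <;> nlinarith
    · rcases hϑ with h | ⟨_, _, h⟩ | ⟨h, h'⟩ <;> nlinarith
  -- Strong signals are detected at the extreme level.
  · refine ⟨1, one_pos, ?_⟩
    have ha0 : 0 ≤ max (1 - s) 0 := le_max_right _ _
    have ha1 : max (1 - s) 0 ≤ 1 / 2 := max_le (by linarith) (by norm_num)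
    have key : max (1 - s) 0 ^ 2 < 1 - ϑ := by
      rcases hϑ with h | ⟨_, h, h'⟩ | ⟨h, h'⟩
      · nlinarith
      · rcases h.lt_or_eq with h | h
        · nlinarith
        · have : 1 / 2 < s := by
            by_contra hh
            have : s = 1 / 2 := le_antisymm (not_lt.1 hh) hs
            rw [this, h] at h'
            norm_num at h'
          have : max (1 - s) 0 < 1 / 2 := max_lt (by linarith) (by norm_num)
          nlinarith
      · have : max (1 - s) 0 < u := max_lt (by linarith) hu0
        nlinarith
    exact ⟨by nlinarith, key, by nlinarith⟩

lemma tendsto_level : Tendsto level atTop atTop := by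
  refine Real.tendsto_sqrt_atTop.comp (Tendsto.const_mul_atTop two_pos ?_)
  exact Real.tendsto_log_atTop.comp tendsto_natCast_atTop_atTop

/-- The Gaussian tail at `a √(2 log p)` is at least `p ^ (-a²)`, up to a factor `p ^ (-η)`. -/
lemma eventually_le_tail {a η : ℝ} (ha : 0 ≤ a) (hη : 0 < η) :
    ∀ᶠ p : ℕ in atTop, ∀ c ≤ a * level p, (p : ℝ) ^ (-(a ^ 2) - η) ≤ tail c := by
  have h1 := tendsto_level.eventually_ge_atTop (2 * (a + 3) / η)
  have h2 := tendsto_level.eventually_ge_atTop 1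
  filter_upwards [h1, h2, eventually_gt_atTop 0] with p h1 h2 hp c hc
  refine le_trans ?_ (le_tail (mul_nonneg ha (level_nonneg p)) hc)
  rw [← exp_mul_level_sq hp, le_div_iff₀ (by norm_num)]
  have h3 : (3 : ℝ) ≤ Real.exp 2 := by linarith [Real.add_one_le_exp (2 : ℝ)]
  calc Real.exp ((-(a ^ 2) - η) * level p ^ 2 / 2) * 3
      ≤ Real.exp ((-(a ^ 2) - η) * level p ^ 2 / 2) * Real.exp 2 := by gcongr
    _ ≤ _ := by
      rw [← Real.exp_add]
      refine Real.exp_le_exp.2 ?_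
      rw [div_le_iff₀ hη] at h1
      nlinarith [mul_le_mul_of_nonneg_right h1 (level_nonneg p)]

/-- Above the boundary, the test based on the number of exceedances of a suitable level is
asymptotically powerful. -/
theorem exists_tests_of_rhoStar_lt {ϑ r : ℝ} (hϑ0 : 0 < ϑ) (hϑ1 : ϑ < 1) (hr : 0 < r)
    {Ω : ∀ p : ℕ, Matrix (Fin p) (Fin p) ℝ} (hΩ : IsSparsePrecision Ω) (h : rhoStar ϑ < r) :
    ∃ φ : ∀ p : ℕ, EuclideanSpace ℝ (Fin p) → ℝ, (∀ p, IsNonrandomizedTest (φ p)) ∧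
      Tendsto (fun p : ℕ => typeI (Ω p) (φ p) + typeII ϑ r (Ω p) (φ p)) atTop (𝓝 0) := by
  obtain ⟨σ, hσ, h1, h2, h3⟩ := exists_exponent_of_rhoStar_lt hϑ1 hr h
  set s := Real.sqrt r with hs
  set a := max (σ - s) 0 with ha
  have ha0 : 0 ≤ a := le_max_right _ _
  -- The slack left by the three strict inequalities absorbs the factors `p ^ η`.
  obtain ⟨η, hη, hη1, hη2, hη3⟩ : ∃ η : ℝ, 0 < η ∧ a ^ 2 + η < σ ^ 2 ∧ a ^ 2 + η < 1 - ϑ ∧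
      2 * ϑ + 2 * a ^ 2 + 2 * η < 1 + σ ^ 2 := by
    let x := min (σ ^ 2 - a ^ 2) (min (1 - ϑ - a ^ 2) ((1 + σ ^ 2 - 2 * ϑ - 2 * a ^ 2) / 2))
    have hx : 0 < x := lt_min (by linarith) (lt_min (by linarith) (by linarith))
    have hx1 : x ≤ σ ^ 2 - a ^ 2 := min_le_left _ _
    have hx2 : x ≤ 1 - ϑ - a ^ 2 := (min_le_right _ _).trans (min_le_left _ _)
    have hx3 : x ≤ (1 + σ ^ 2 - 2 * ϑ - 2 * a ^ 2) / 2 :=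
      (min_le_right _ _).trans (min_le_right _ _)
    exact ⟨x / 2, by linarith, by linarith, by linarith, by linarith⟩
  let d (p : ℕ) : ℕ := maxRowNonzeros (Ω p)
  let t (p : ℕ) : ℝ := σ * level p
  let g (p : ℕ) : ℝ := (p : ℝ) ^ (1 - ϑ - a ^ 2 - η) / 4
  let φ (p : ℕ) := countTest (Ω p) (t p) (p * tail (t p) + g p / 2)
  refine ⟨φ, fun p => isNonrandomizedTest_countTest _ _, ?_⟩
  have hlim : Tendsto (fun p : ℕ =>
      128 * ((d p : ℝ) ^ 2 * (p : ℝ) ^ (2 * ϑ + 2 * a ^ 2 + 2 * η - 1 - σ ^ 2)) +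
      16 * ((d p : ℝ) ^ 2 * (p : ℝ) ^ (-(1 - ϑ - a ^ 2 - η)))) atTop (𝓝 0) := by
    have l1 := (tendsto_maxRowNonzeros_sq_mul_rpow hΩ
      (show 2 * ϑ + 2 * a ^ 2 + 2 * η - 1 - σ ^ 2 < 0 by linarith)).const_mul 128
    have l2 := (tendsto_maxRowNonzeros_sq_mul_rpow hΩ
      (show -(1 - ϑ - a ^ 2 - η) < 0 by linarith)).const_mul 16
    simpa using l1.add l2
  have hsmall1 : ∀ᶠ p : ℕ in atTop, (d p : ℝ) * (p : ℝ) ^ (-ϑ) ≤ 1 / 2 :=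
    (tendsto_maxRowNonzeros_mul_rpow hΩ (show -ϑ < 0 by linarith)).eventually_le_const
      (by norm_num)
  have hsmall2 : ∀ᶠ p : ℕ in atTop, (d p : ℝ) * (p : ℝ) ^ (a ^ 2 + η - σ ^ 2) ≤ 1 / 4 :=
    (tendsto_maxRowNonzeros_mul_rpow hΩ
      (show a ^ 2 + η - σ ^ 2 < 0 by linarith)).eventually_le_const (by norm_num)
  refine tendsto_of_tendsto_of_tendsto_of_le_of_le' tendsto_const_nhds hlim ?_ ?_
  · refine Eventually.of_forall fun p => add_nonneg ?_ ?_
    · exact integral_nonneg fun y => ((isNonrandomizedTest_countTest _ _).1.2 y).1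
    · refine integral_nonneg fun y => ?_
      have := ((isNonrandomizedTest_countTest (Ω := Ω p) (t p)
        (p * tail (t p) + g p / 2)).1.2 y).2
      exact sub_nonneg.2 this
  filter_upwards [hsmall1, hsmall2, eventually_le_tail ha0 hη, eventually_gt_atTop 0] with
    p hd1 hd2 htail hp
  have hp' : (0 : ℝ) < p := by exact_mod_cast hp
  have hε := eps_mem_Icc hϑ0 p
  have : Fact (eps ϑ p ∈ Set.Icc (0 : ℝ) 1) := ⟨hε⟩
  have hl := level_nonneg p
  have hτ : tau r p = s * level p := tau_eq hr.le p
  have hg : 0 < g p := by simp only [g]; positivity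
  have hupper : tail (t p) ≤ (p : ℝ) ^ (-σ ^ 2) := by
    refine (tail_le (mul_nonneg hσ.le hl)).trans_eq ?_
    rw [← exp_mul_level_sq hp, show -t p ^ 2 / 2 = -σ ^ 2 * level p ^ 2 / 2 by simp only [t]; ring]
  have hlower : (p : ℝ) ^ (-(a ^ 2) - η) ≤ tail (t p - tau r p) := by
    refine htail _ ?_
    rw [hτ, ← sub_mul]
    exact mul_le_mul_of_nonneg_right (le_max_left _ _) hl
  have hgap : p * tail (t p) + g p ≤
      ∑ i, (altLaw ϑ r (Ω p)).real (exceed (Ω p) (t p) i) := by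
    have hterm (i : Fin p) : tail (t p) + eps ϑ p * ((p : ℝ) ^ (-(a ^ 2) - η) / 4) ≤
        (altLaw ϑ r (Ω p)).real (exceed (Ω p) (t p) i) := by
      refine le_trans ?_ (le_rareLaw_real_exceed (hΩ.posDef p) (hΩ.diag p) (card_nbr_le (Ω p))
        (t p) i)
      have q1 : (d p : ℝ) * tail (t p) ≤ (p : ℝ) ^ (-(a ^ 2) - η) / 4 := by
        have e : (p : ℝ) ^ (-σ ^ 2) = (p : ℝ) ^ (a ^ 2 + η - σ ^ 2) * (p : ℝ) ^ (-(a ^ 2) - η) := by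
          rw [← Real.rpow_add hp']; congr 1; ring
        have hx : 0 < (p : ℝ) ^ (-(a ^ 2) - η) := Real.rpow_pos_of_pos hp' _
        calc (d p : ℝ) * tail (t p) ≤ (d p : ℝ) * (p : ℝ) ^ (-σ ^ 2) := by gcongr
          _ = ((d p : ℝ) * (p : ℝ) ^ (a ^ 2 + η - σ ^ 2)) * (p : ℝ) ^ (-(a ^ 2) - η) := by
              rw [e]; ring
          _ ≤ 1 / 4 * (p : ℝ) ^ (-(a ^ 2) - η) := by gcongr
          _ = _ := by ring
      have q2 : (p : ℝ) ^ (-(a ^ 2) - η) / 2 ≤ (1 - d p * eps ϑ p) * tail (t p - tau r p) := by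
        have : 1 / 2 ≤ 1 - d p * eps ϑ p := by
          rw [eps]; linarith
        nlinarith [tail_nonneg (t p - tau r p)]
      have q3 := mul_le_mul_of_nonneg_left (sub_le_sub q2 q1) hε.1
      simp only [d] at q3 ⊢
      linarith
    have e : (p : ℝ) * (eps ϑ p * ((p : ℝ) ^ (-(a ^ 2) - η) / 4)) = g p := by
      have : (p : ℝ) * eps ϑ p * (p : ℝ) ^ (-(a ^ 2) - η) = (p : ℝ) ^ (1 - ϑ - a ^ 2 - η) := by
        rw [eps]
        nth_rw 1 [← Real.rpow_one (p : ℝ)]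
        rw [← Real.rpow_add hp', ← Real.rpow_add hp']
        congr 1; ring
      simp only [g]
      rw [← this]; ring
    calc _ = ∑ i : Fin p, (tail (t p) + eps ϑ p * ((p : ℝ) ^ (-(a ^ 2) - η) / 4)) := by
          simp only [Finset.sum_const, Finset.card_univ, Fintype.card_fin, nsmul_eq_mul, mul_add, e]
      _ ≤ _ := Finset.sum_le_sum fun i _ => hterm i
  refine (errors_countTest_le (hΩ.posDef p) (hΩ.diag p) (card_nbr_le (Ω p)) hε (t p) hg
    hgap).trans ?_
  have e1 : (p : ℝ) * (p : ℝ) ^ (-σ ^ 2) / g p ^ 2 =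
      16 * (p : ℝ) ^ (2 * ϑ + 2 * a ^ 2 + 2 * η - 1 - σ ^ 2) := by
    have hx : (p : ℝ) ^ (1 - ϑ - a ^ 2 - η) ≠ 0 := (Real.rpow_pos_of_pos hp' _).ne'
    have : (p : ℝ) * (p : ℝ) ^ (-σ ^ 2) = (p : ℝ) ^ (2 * ϑ + 2 * a ^ 2 + 2 * η - 1 - σ ^ 2) *
        ((p : ℝ) ^ (1 - ϑ - a ^ 2 - η) * (p : ℝ) ^ (1 - ϑ - a ^ 2 - η)) := by
      nth_rw 1 [← Real.rpow_one (p : ℝ)]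
      rw [← Real.rpow_add hp', ← Real.rpow_add hp', ← Real.rpow_add hp']
      congr 1; ring
    rw [this]
    simp only [g]
    field_simp; norm_num
  have e2 : 1 / g p = 4 * (p : ℝ) ^ (-(1 - ϑ - a ^ 2 - η)) := by
    rw [Real.rpow_neg hp'.le]
    simp only [g]
    rw [one_div_div]; rfl
  calc 4 * (d p : ℝ) ^ 2 * (2 * (p * tail (t p) / g p ^ 2) + 1 / g p)
      ≤ 4 * (d p : ℝ) ^ 2 * (2 * (p * (p : ℝ) ^ (-σ ^ 2) / g p ^ 2) + 1 / g p) := by gcongr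
    _ = _ := by rw [e1, e2]; ring

end ARW

end

theorem mainTheorem2 (ϑ r : ℝ) (hϑ0 : 0 < ϑ) (hϑ1 : ϑ < 1) (hr : 0 < r)
    (Ω : ∀ p : ℕ, Matrix (Fin p) (Fin p) ℝ) (hΩ : ARW.IsSparsePrecision Ω) :
    (r < ARW.rhoStar ϑ →
      ∀ φ : ∀ p : ℕ, EuclideanSpace ℝ (Fin p) → ℝ, (∀ p, ARW.IsTest (φ p)) →
        Tendsto (fun p : ℕ => ARW.typeI (Ω p) (φ p) + ARW.typeII ϑ r (Ω p) (φ p)) atTop (𝓝 1)) ∧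
    (ARW.rhoStar ϑ < r →
      ∃ φ : ∀ p : ℕ, EuclideanSpace ℝ (Fin p) → ℝ, (∀ p, ARW.IsNonrandomizedTest (φ p)) ∧
        Tendsto (fun p : ℕ => ARW.typeI (Ω p) (φ p) + ARW.typeII ϑ r (Ω p) (φ p)) atTop
          (𝓝 0)) := by
  exact ⟨fun h _ hφ => ARW.tendsto_errors_of_lt_rhoStar hϑ0 hϑ1 hr hΩ h hφ,
    fun h => ARW.exists_tests_of_rhoStar_lt hϑ0 hϑ1 hr hΩ h⟩
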